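/- Let $0<\mathfrak n_1<\mathfrak n_2$, $-\infty<s_-<s_+<+\infty$, $\eta_-\in(-\infty,0]\cup\{\infty\}$ and $\eta_+\in[\mathfrak n_1,\mathfrak n_2]$. Let $\mathbb F$ be the set of real functions $\varepsilon\in L^\infty(s_-,s_+)$ with $\mathfrak n_1^2\le\varepsilon\le\mathfrak n_2^2$ a.e. on $(s_-,s_+)$. A number $\kappa\in\mathbb C\setminus\{0\}$ is an $(\eta_-,\eta_+)$-eigenvalue of $\varepsilon\in\mathbb F$ if $y''=-\kappa^2\varepsilon y$ a.e. on $(s_-,s_+)$ has a nontrivial solution $y\in W^{2,\infty}(s_-,s_+)$ with $\frac{y'(s_\pm)}{i\kappa y(s_\pm)}=\eta_\pm$ (understood as $y(s_-)=0$ at $s_-$ if $\eta_-=\infty$). Let $\Sigma$ be the set of all $(\eta_-,\eta_+)$-eigenvalues of all $\varepsilon\in\mathbb F$. Let $\operatorname{Arg}_0\kappa\in(-\pi,\pi]$ be the complex argument of $\kappa\ne0$; call $\gamma\in\mathbb R$ achievable if $\gamma=\operatorname{Arg}_0\kappa$ for some $\kappa\in\Sigma$. With the convention $\inf\varnothing=+\infty$,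 put $$\rho_{\min}(\gamma)=\inf\{|\kappa|:\kappa\in\Sigma,\ \operatorname{Arg}_0\kappa=\gamma\},\quad \operatorname{dom}\rho_{\min}=\{\gamma\in\mathbb R:\rho_{\min}(\gamma)<+\infty\},\quad \mathfrak P_{\mathrm{mod}}=\{e^{i\gamma}\rho_{\min}(\gamma):\gamma\text{ achievable}\}.$$ For $S\subset\mathbb C$ and $\alpha\in\mathbb R$ put $\beta_S(\alpha)=\inf\{\beta\in\mathbb R:\alpha-i\beta\in S\}\in[-\infty,+\infty]$ and $\mathfrak P_{\mathrm{Dr}}(S)=\{\alpha-i\beta_S(\alpha):\alpha\in\mathbb R,\ \beta_S(\alpha)\in\mathbb R\}$. So $\beta_{\min}=\beta_\Sigma$ is the minimal decay rate, and $\mathfrak P_{\mathrm{Dr}}(\Sigma)$ is the Pareto frontier of minimal decay. Then: (i) $\operatorname{dom}\rho_{\min}$ is the set of achievable $\gamma$, $$(-\pi,0)\setminus\{-\pi/2\}\subset\operatorname{dom}\rho_{\min}\subset(-\pi,0),\qquad \Sigma=\{c\,e^{i\gamma}\rho_{\min}(\gamma):c\in[1,+\infty),\ \gamma\text{ achievable}\}.$$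 In particular, the resonance-free region $\mathbb C\setminus\Sigma$ contains $0$ and is star-shaped with respect to $0$. (ii) The Pareto frontier of minimal decay is determined by $\mathfrak P_{\mathrm{mod}}$: for all $\alpha\in\mathbb R$, $$\beta_{\min}(\alpha)=\inf\{-c\operatorname{Im}k:\ c\in[1,+\infty),\ k\in\mathfrak P_{\mathrm{mod}},\ c\operatorname{Re}k=\alpha\},$$ and $\mathfrak P_{\mathrm{Dr}}(\Sigma)=\mathfrak P_{\mathrm{Dr}}\big(\{ck:c\in[1,+\infty),\ k\in\mathfrak P_{\mathrm{mod}}\}\big)$. -/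

import Mathlib

open MeasureTheory Set
open scoped OnePoint

noncomputable section

namespace ResonanceOpt

/-- The feasible family on `(a, b)`: real `L^∞` functions with `n₁² ≤ ε ≤ n₂²` almost everywhere
on `(a, b)`.  An equivalence class is represented by any of its representatives; all notions below
depend only on the class of `ε` in `L^∞ (a, b)`. -/
structure Feasible (n₁ n₂ a b : ℝ) (ε : ℝ → ℝ) : Prop where
  aemeasurable : AEMeasurable ε (volume.restrict (Ioo a b))
  bounds : ∀ᵐ s ∂(volume.restrict (Ioo a b)), n₁ ^ 2 ≤ ε s ∧ ε s ≤ n₂ ^ 2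

/-- `y` is a solution on `[a, b]` of `y'' = -κ² ε y` (almost everywhere), with derivative `y' = v`:
`y` is `C¹` and `v` is an antiderivative of the integrable function `-κ² ε y`, that is, `v` is
absolutely continuous and `v' = -κ² ε y` almost everywhere. -/
structure IsSolution (a b : ℝ) (ε : ℝ → ℝ) (κ : ℂ) (y v : ℝ → ℂ) : Prop where
  deriv_eq : ∀ s ∈ Icc a b, HasDerivWithinAt y (v s) (Icc a b) s
  eqn : ∀ s ∈ Icc a b, v s = v a + ∫ t in a..s, -κ ^ 2 * (ε t : ℂ) * y t

/-- The boundary condition `y' / (i κ y) = η` at a point where `y`, `y'` take the values `y₀`, `v₀`,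
for `η` in the Riemann sphere; it means `y₀ = 0` when `η = ∞`. -/
def BoundaryCondition (η : OnePoint ℂ) (κ y₀ v₀ : ℂ) : Prop :=
  (η = ∞ ∧ y₀ = 0) ∨ (y₀ ≠ 0 ∧ η = ((v₀ / (Complex.I * κ * y₀) : ℂ) : OnePoint ℂ))

/-- The set of `(η₋; η₊)`-eigenvalues of `ε` on `(a, b)`. -/
def eigenvalues (ηm ηp : OnePoint ℂ) (a b : ℝ) (ε : ℝ → ℝ) : Set ℂ :=
  {κ | κ ≠ 0 ∧ ∃ y v : ℝ → ℂ, IsSolution a b ε κ y v ∧ (∃ s ∈ Icc a b, y s ≠ 0) ∧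
    BoundaryCondition ηm κ (y a) (v a) ∧ BoundaryCondition ηp κ (y b) (v b)}

/-- The set of achievable `(η₋; η₊)`-eigenvalues over the feasible family. -/
def achievable (n₁ n₂ : ℝ) (ηm ηp : OnePoint ℂ) (a b : ℝ) : Set ℂ :=
  {κ | ∃ ε : ℝ → ℝ, Feasible n₁ n₂ a b ε ∧ κ ∈ eigenvalues ηm ηp a b ε}

/-- The set of achievable `(η₋; η₊)`-arguments; the argument is normalized to `(-π, π]`. -/
def achievableArgs (n₁ n₂ : ℝ) (ηm ηp : OnePoint ℂ) (a b : ℝ) : Set ℝ :=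
  Complex.arg '' achievable n₁ n₂ ηm ηp a b

/-- The minimal modulus `ρ_min (γ)`, with values in `[0, +∞]`; the infimum over `∅` is `+∞`. -/
def rhoMin (n₁ n₂ : ℝ) (ηm ηp : OnePoint ℂ) (a b γ : ℝ) : ENNReal :=
  sInf {r | ∃ κ ∈ achievable n₁ n₂ ηm ηp a b, Complex.arg κ = γ ∧ r = ENNReal.ofReal ‖κ‖}

/-- `dom ρ_min`, the set where `ρ_min` is finite. -/
def domRhoMin (n₁ n₂ : ℝ) (ηm ηp : OnePoint ℂ) (a b : ℝ) : Set ℝ :=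
  {γ | rhoMin n₁ n₂ ηm ηp a b γ < ⊤}

/-- The point `e^{iγ} ρ_min (γ)`, used only for achievable `γ`, where `ρ_min (γ)` is finite. -/
def minModulusPoint (n₁ n₂ : ℝ) (ηm ηp : OnePoint ℂ) (a b γ : ℝ) : ℂ :=
  Complex.exp (Complex.I * (γ : ℂ)) * ((rhoMin n₁ n₂ ηm ηp a b γ).toReal : ℂ)

/-- The Pareto frontier of minimal modulus. -/
def modulusFrontier (n₁ n₂ : ℝ) (ηm ηp : OnePoint ℂ) (a b : ℝ) : Set ℂ :=
  {k | ∃ γ ∈ achievableArgs n₁ n₂ ηm ηp a b, k = minModulusPoint n₁ n₂ ηm ηp a b γ}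

/-- The minimal decay rate `inf {β ∈ ℝ : α - iβ ∈ S}` over a set `S` of eigenvalues, for the
frequency `α`, taken in `[-∞, +∞]`; the infimum over `∅` is `+∞`. -/
def minDecayRate (S : Set ℂ) (α : ℝ) : EReal :=
  sInf {r | ∃ β : ℝ, (α : ℂ) - Complex.I * (β : ℂ) ∈ S ∧ r = (β : EReal)}

/-- The Pareto frontier of minimal decay of a set `S` of eigenvalues: the points `α - iβ` such that
the minimal decay rate for the frequency `α` is finite and equal to `β`. -/
def decayFrontier (S : Set ℂ) : Set ℂ :=
  {κ | ∃ α β : ℝ, minDecayRate S α = (β : EReal) ∧ κ = (α : ℂ) - Complex.I * (β : ℂ)}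

end ResonanceOpt

end

namespace ResonanceOpt

open Filter Topology

/-! With `μ = I * κ` and `w = y' / μ` the equation becomes the control system `y' = μ w`, `w' = μ ε
y`, and the boundary conditions say that `ε` steers one fixed complex line of states to the line `w
= p y`, where `p` is `η₊`. Thus `Σ` corresponds to `steeringSet` (`mem_achievable_iff`), and four
facts carry the theorem.

Half-plane (`re_pos_of_mem_steeringSet`): the flux `Re (ȳ w)` has derivative `Re μ (ε |y|² + |w|²)`,
is nonpositive at the left end and positive at the right end, so `Re μ > 0`, that is, `Im κ < 0`.

Dilation (`dilation_mem_steeringSet`): since `p ∈ [n₁, n₂]`, the control `p²` is admissible and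
preserves the line `w = p y`. A steering can therefore be prolonged to any longer interval, and
rescaling back multiplies `μ` by the ratio of lengths.

Closedness (`isClosed_steeringSet`): controls are weakly compact. Passing to the primitives of the
controls makes pointwise limits sufficient.

Arguments (`exists_smul_mem_steeringSet`): for nonreal `μ` with `Re μ > 0`, steering succeeds in
some time. In the projective coordinate `(w - p y) / (w + p y)` the control `p²` moves the state
along a logarithmic spiral into `0`, while the states that a second constant control brings to `0`
form a curve leaving `0` with nonzero velocity. The spiral crosses that curve
(`exists_eq_exp_neg_mul`). For real `μ`, that is `γ = -π/2`, it does not wind, which is why this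
angle is excluded.

By dilation and closedness, each ray with achievable argument meets `Σ` in a closed half-line
starting at the minimal modulus; all the claims follow. -/

/-! ### Calculus of Lipschitz functions differentiable almost everywhere. -/

theorem integral_deriv_eq_sub_of_lipschitzOnWith {E : Type*} [NormedAddCommGroup E]
    [NormedSpace ℝ E] [CompleteSpace E] [SecondCountableTopology E] [MeasurableSpace E]
    [BorelSpace E] {f : ℝ → E} {a b : ℝ} {K : NNReal} (hab : a ≤ b)
    (hf : LipschitzOnWith K f (Icc a b))
    (hd : ∀ᵐ s, s ∈ Ioo a b → DifferentiableAt ℝ f s) :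
    IntervalIntegrable (deriv f) volume a b ∧ ∫ s in a..b, deriv f s = f b - f a := by
  have hK : ∀ s ∈ Ioo a b, ‖deriv f s‖ ≤ K := fun s hs =>
    norm_deriv_le_of_lipschitzOn (Icc_mem_nhds hs.1 hs.2) hf
  have hne : ∀ᵐ s : ℝ, s ≠ a ∧ s ≠ b := by
    have h₁ : ∀ᵐ x : ℝ, x ≠ a := by simp [ae_iff, measure_singleton]
    have h₂ : ∀ᵐ x : ℝ, x ≠ b := by simp [ae_iff, measure_singleton]
    filter_upwards [h₁, h₂] with s h1 h2 using ⟨h1, h2⟩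
  have hint : IntervalIntegrable (deriv f) volume a b := by
    rw [intervalIntegrable_iff_integrableOn_Ioo_of_le hab]
    refine Measure.integrableOn_of_bounded (M := K) (by simp)
      (measurable_deriv f).aestronglyMeasurable ?_
    exact (ae_restrict_iff' measurableSet_Ioo).2 (Eventually.of_forall hK)
  refine ⟨hint, ?_⟩
  have hsub : ∀ s ∈ Icc a b, ∀ t ∈ Icc a b, ‖∫ x in s..t, deriv f x‖ ≤ K * |t - s| := by
    intro s hs t ht
    refine intervalIntegral.norm_integral_le_of_norm_le_const_ae ?_
    filter_upwards [hne] with x hx hxs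
    have : x ∈ Icc a b := by
      have := uIoc_subset_uIcc hxs
      exact uIcc_subset_Icc hs ht this
    exact hK x ⟨lt_of_le_of_ne this.1 hx.1.symm, lt_of_le_of_ne this.2 hx.2⟩
  have hI : ∀ t ∈ Icc a b, IntervalIntegrable (deriv f) volume a t := fun t ht =>
    hint.mono_set (by rw [uIcc_of_le hab, uIcc_of_le ht.1]; exact Icc_subset_Icc_right ht.2)
  have hF : LipschitzOnWith K (fun t => ∫ x in a..t, deriv f x) (Icc a b) := by
    refine LipschitzOnWith.of_dist_le_mul fun s hs t ht => ?_
    rw [dist_comm, dist_eq_norm, intervalIntegral.integral_interval_sub_left (hI t ht) (hI s hs),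
      dist_comm, Real.dist_eq]
    exact hsub s hs t ht
  -- `f` minus the primitive of its derivative is absolutely continuous with derivative zero almost
  -- everywhere, hence constant.
  have hg : AbsolutelyContinuousOnInterval (fun t => f t - ∫ x in a..t, deriv f x) a b :=
    AbsolutelyContinuousOnInterval.fun_sub
      (LipschitzOnWith.absolutelyContinuousOnInterval (by rwa [uIcc_of_le hab]))
      (LipschitzOnWith.absolutelyContinuousOnInterval (by rwa [uIcc_of_le hab]))
  obtain ⟨C, hC⟩ := hg.const_of_ae_hasDerivAt_zero (by
    filter_upwards [hd, hint.ae_hasDerivAt_integral, hne] with x h1 h2 h3 hx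
    have hx' := hx
    rw [uIcc_of_le hab] at hx'
    have := (h1 ⟨lt_of_le_of_ne hx'.1 h3.1.symm, lt_of_le_of_ne hx'.2 h3.2⟩).hasDerivAt.sub
      (h2 hx a left_mem_uIcc)
    rw [sub_self] at this
    exact this)
  have h1 := hC a left_mem_uIcc
  have h2 := hC b right_mem_uIcc
  simp only [intervalIntegral.integral_same, sub_zero] at h1
  rw [← h1] at h2
  rw [← h2]; abel

theorem integral_eq_sub_of_ae_hasDerivAt {E : Type*} [NormedAddCommGroup E]
    [NormedSpace ℝ E] [CompleteSpace E] [SecondCountableTopology E] [MeasurableSpace E]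
    [BorelSpace E] {f f' : ℝ → E} {a b : ℝ} {K : NNReal} (hab : a ≤ b)
    (hf : LipschitzOnWith K f (Icc a b))
    (hd : ∀ᵐ s, s ∈ Ioo a b → HasDerivAt f (f' s) s) :
    ∫ s in a..b, f' s = f b - f a := by
  rw [← (integral_deriv_eq_sub_of_lipschitzOnWith hab hf
    (hd.mono fun s hs h => (hs h).differentiableAt)).2]
  refine intervalIntegral.integral_congr_ae ?_
  have h₂ : ∀ᵐ x : ℝ, x ≠ b := by simp [ae_iff, measure_singleton]
  filter_upwards [hd, h₂] with s hs h2 hsb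
  rw [uIoc_of_le hab] at hsb
  exact (hs ⟨hsb.1, lt_of_le_of_ne hsb.2 h2⟩).deriv.symm

/-- Mean value inequality for Lipschitz functions with an almost everywhere bounded derivative. -/
theorem norm_sub_le_of_ae_hasDerivAt {E : Type*} [NormedAddCommGroup E]
    [NormedSpace ℝ E] [CompleteSpace E] [SecondCountableTopology E] [MeasurableSpace E]
    [BorelSpace E] {f f' : ℝ → E} {a b s t C : ℝ} {K : NNReal}
    (hf : LipschitzOnWith K f (Icc a b))
    (hd : ∀ᵐ x, x ∈ Ioo a b → HasDerivAt f (f' x) x)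
    (hs : s ∈ Icc a b) (ht : t ∈ Icc a b) (hC : ∀ x ∈ uIcc s t, ‖f' x‖ ≤ C) :
    ‖f t - f s‖ ≤ C * |t - s| := by
  wlog hst : s ≤ t generalizing s t
  · rw [norm_sub_rev, abs_sub_comm]
    exact this ht hs (by rwa [uIcc_comm]) (le_of_not_ge hst)
  rw [← integral_eq_sub_of_ae_hasDerivAt hst (hf.mono (Icc_subset_Icc hs.1 ht.2))
    (hd.mono fun x hx h => hx ⟨hs.1.trans_lt h.1, h.2.trans_le ht.2⟩)]
  exact intervalIntegral.norm_integral_le_of_norm_le_const fun x hx => hC x (uIoc_subset_uIcc hx)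

theorem le_of_ae_hasDerivAt_nonneg {f f' : ℝ → ℝ} {a b : ℝ} (hab : a ≤ b)
    (hf : AbsolutelyContinuousOnInterval f a b)
    (hd : ∀ᵐ s, s ∈ Ioo a b → HasDerivAt f (f' s) s ∧ 0 ≤ f' s) : f a ≤ f b := by
  rw [← sub_nonneg, ← hf.integral_deriv_eq_sub]
  refine intervalIntegral.integral_nonneg_of_ae_restrict hab ?_
  rw [EventuallyLE, ← restrict_Ioo_eq_restrict_Icc, ae_restrict_iff' measurableSet_Ioo]
  filter_upwards [hd] with s hs h
  rw [(hs h).1.deriv]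
  exact (hs h).2

theorem intervalIntegrable_of_norm_le {E : Type*} [NormedAddCommGroup E]
    {f : ℝ → E} {C : ℝ} (hf : AEStronglyMeasurable f) (hC : ∀ s, ‖f s‖ ≤ C) (a b : ℝ) :
    IntervalIntegrable f volume a b := by
  refine (intervalIntegrable_const (c := C)).mono_fun hf.restrict ?_
  exact Eventually.of_forall fun s => (hC s).trans (le_abs_self C)

theorem locallyIntegrable_of_norm_le {E : Type*} [NormedAddCommGroup E]
    {f : ℝ → E} {C : ℝ} (hf : AEStronglyMeasurable f) (hC : ∀ s, ‖f s‖ ≤ C) :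
    LocallyIntegrable f := by
  intro x
  refine ⟨Ioo (x - 1) (x + 1), Ioo_mem_nhds (by linarith) (by linarith), ?_⟩
  rw [← intervalIntegrable_iff_integrableOn_Ioo_of_le (by linarith)]
  exact intervalIntegrable_of_norm_le hf hC _ _

/-! ### Trajectories of the first-order system: energy and flux. -/

/-- A trajectory on `[a, b]` of the linear system `y' = μ w`, `w' = μ ε y`. -/
structure IsTrajectory (μ : ℂ) (ε : ℝ → ℝ) (a b : ℝ) (y w : ℝ → ℂ) : Prop where
  lipschitz_fst : ∃ K, LipschitzOnWith K y (Icc a b)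
  lipschitz_snd : ∃ K, LipschitzOnWith K w (Icc a b)
  ae_hasDerivAt_fst : ∀ᵐ s, s ∈ Ioo a b → HasDerivAt y (μ * w s) s
  ae_hasDerivAt_snd : ∀ᵐ s, s ∈ Ioo a b → HasDerivAt w (μ * (ε s * y s)) s

/-- Measurable controls with values in `[n₁², n₂²]` everywhere. -/
structure IsControl (n₁ n₂ : ℝ) (ε : ℝ → ℝ) : Prop where
  measurable : Measurable ε
  mem : ∀ s, ε s ∈ Icc (n₁ ^ 2) (n₂ ^ 2)

theorem IsControl.nonneg {n₁ n₂ : ℝ} {ε : ℝ → ℝ} (h : IsControl n₁ n₂ ε) (s : ℝ) : 0 ≤ ε s :=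
  (sq_nonneg n₁).trans (h.mem s).1

theorem IsControl.norm_le {n₁ n₂ : ℝ} {ε : ℝ → ℝ} (h : IsControl n₁ n₂ ε) (s : ℝ) :
    ‖(ε s : ℂ)‖ ≤ n₂ ^ 2 := by
  rw [Complex.norm_real, Real.norm_of_nonneg (h.nonneg s)]
  exact (h.mem s).2

theorem isControl_const {n₁ n₂ m : ℝ} (hn₁ : 0 < n₁) (hm : m ∈ Icc n₁ n₂) :
    IsControl n₁ n₂ fun _ => m ^ 2 :=
  ⟨measurable_const, fun _ => ⟨by gcongr; exact hm.1, by
    have := hn₁.trans_le hm.1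
    gcongr; exact hm.2⟩⟩

theorem absolutelyContinuousOnInterval_inner {f g : ℝ → ℂ} {a b : ℝ} {K L : NNReal} (hab : a ≤ b)
    (hf : LipschitzOnWith K f (Icc a b)) (hg : LipschitzOnWith L g (Icc a b)) :
    AbsolutelyContinuousOnInterval (fun s => inner ℝ (f s) (g s)) a b := by
  rw [← uIcc_of_le hab] at hf hg
  have fr := (Complex.reCLM.lipschitz.comp_lipschitzOnWith hf).absolutelyContinuousOnInterval
  have fi := (Complex.imCLM.lipschitz.comp_lipschitzOnWith hf).absolutelyContinuousOnInterval
  have gr := (Complex.reCLM.lipschitz.comp_lipschitzOnWith hg).absolutelyContinuousOnInterval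
  have gi := (Complex.imCLM.lipschitz.comp_lipschitzOnWith hg).absolutelyContinuousOnInterval
  convert! (fr.fun_mul gr).fun_add (fi.fun_mul gi) using 2 with s
  simp [Complex.inner]
  ring

theorem absolutelyContinuousOnInterval_exp (c a b : ℝ) :
    AbsolutelyContinuousOnInterval (fun s : ℝ => Real.exp (c * s)) a b :=
  ContDiffOn.absolutelyContinuousOnInterval (by fun_prop)

namespace IsTrajectory

variable {μ : ℂ} {ε : ℝ → ℝ} {a b : ℝ} {y w : ℝ → ℂ}

theorem mono (h : IsTrajectory μ ε a b y w) {s t : ℝ} (hs : s ∈ Icc a b) (ht : t ∈ Icc a b) :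
    IsTrajectory μ ε s t y w := by
  obtain ⟨⟨K, hK⟩, ⟨L, hL⟩, h1, h2⟩ := h
  refine ⟨⟨K, hK.mono (Icc_subset_Icc hs.1 ht.2)⟩, ⟨L, hL.mono (Icc_subset_Icc hs.1 ht.2)⟩, ?_, ?_⟩
  · exact h1.mono fun x hx h => hx ⟨hs.1.trans_lt h.1, h.2.trans_le ht.2⟩
  · exact h2.mono fun x hx h => hx ⟨hs.1.trans_lt h.1, h.2.trans_le ht.2⟩

theorem continuousOn_snd (h : IsTrajectory μ ε a b y w) : ContinuousOn w (Icc a b) :=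
  h.lipschitz_snd.choose_spec.continuousOn

theorem const_mul (h : IsTrajectory μ ε a b y w) (c : ℂ) :
    IsTrajectory μ ε a b (fun s => c * y s) (fun s => c * w s) := by
  obtain ⟨⟨K, hK⟩, ⟨L, hL⟩, h1, h2⟩ := h
  refine ⟨⟨_, (ContinuousLinearMap.mul ℝ ℂ c).lipschitz.comp_lipschitzOnWith hK⟩,
    ⟨_, (ContinuousLinearMap.mul ℝ ℂ c).lipschitz.comp_lipschitzOnWith hL⟩, ?_, ?_⟩
  · filter_upwards [h1] with s hs h
    exact ((hs h).const_mul c).congr_deriv (by ring)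
  · filter_upwards [h2] with s hs h
    exact ((hs h).const_mul c).congr_deriv (by ring)

/-- The energy `‖y‖² + ‖w‖²` changes by at most an exponential factor (forwards and backwards). -/
theorem energy_le {n₁ n₂ : ℝ} (hε : IsControl n₁ n₂ ε) (h : IsTrajectory μ ε a b y w)
    {s t : ℝ} (hs : s ∈ Icc a b) (ht : t ∈ Icc a b) :
    ‖y t‖ ^ 2 + ‖w t‖ ^ 2 ≤
      (‖y s‖ ^ 2 + ‖w s‖ ^ 2) * Real.exp (‖μ‖ * (1 + n₂ ^ 2) * |t - s|) := by
  -- The quantity `σ (‖y‖² + ‖w‖²) exp (c s)` is nondecreasing when `σ = ±1` and `c` is `σ` times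
  -- the growth rate. The sign `-1` gives the estimate forwards in time, the sign `+1` backwards.
  have key : ∀ c : ℝ, |c| = ‖μ‖ * (1 + n₂ ^ 2) → ∀ s t : ℝ, s ∈ Icc a b → t ∈ Icc a b → s ≤ t →
      ∀ σ : ℝ, |σ| = 1 → σ * c ≥ 0 →
      σ * (‖y s‖ ^ 2 + ‖w s‖ ^ 2) * Real.exp (c * s) ≤
        σ * (‖y t‖ ^ 2 + ‖w t‖ ^ 2) * Real.exp (c * t) := by
    intro c hc s t hs ht hst σ hσ hσc
    obtain ⟨⟨K, hK⟩, ⟨L, hL⟩, h1, h2⟩ := h.mono hs ht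
    have hac := ((((absolutelyContinuousOnInterval_inner hst hK hK).fun_add
      (absolutelyContinuousOnInterval_inner hst hL hL)).const_mul σ).fun_mul
      (absolutelyContinuousOnInterval_exp c s t))
    have := le_of_ae_hasDerivAt_nonneg hst hac (f' := fun x =>
      σ * (inner ℝ (y x) (μ * w x) + inner ℝ (μ * w x) (y x) +
        (inner ℝ (w x) (μ * (ε x * y x)) + inner ℝ (μ * (ε x * y x)) (w x))) * Real.exp (c * x) +
      σ * (inner ℝ (y x) (y x) + inner ℝ (w x) (w x)) * (Real.exp (c * x) * c)) (by
      filter_upwards [h1, h2] with x hx1 hx2 hx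
      refine ⟨?_, ?_⟩
      · have he : HasDerivAt (fun s : ℝ => Real.exp (c * s)) (Real.exp (c * x) * c) x := by
          simpa using ((hasDerivAt_id x).const_mul c).exp
        exact ((((hx1 hx).inner ℝ (hx1 hx)).add ((hx2 hx).inner ℝ (hx2 hx))).const_mul σ).mul he
      · rw [real_inner_self_eq_norm_sq, real_inner_self_eq_norm_sq,
          real_inner_comm (y x) (μ * w x), real_inner_comm (w x) (μ * (ε x * y x))]
        have e1 := abs_real_inner_le_norm (y x) (μ * w x)
        have e2 := abs_real_inner_le_norm (w x) (μ * (ε x * y x))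
        set i1 := inner ℝ (y x) (μ * w x)
        set i2 := inner ℝ (w x) (μ * (ε x * y x))
        rw [norm_mul] at e1
        rw [norm_mul, norm_mul] at e2
        have e3 : ‖w x‖ * (‖μ‖ * (‖(ε x : ℂ)‖ * ‖y x‖)) ≤ ‖w x‖ * (‖μ‖ * (n₂ ^ 2 * ‖y x‖)) := by
          gcongr; exact hε.norm_le x
        have e4 : σ * c = ‖μ‖ * (1 + n₂ ^ 2) := by
          rw [← hc, ← abs_of_nonneg hσc, abs_mul, hσ, one_mul]
        have e5 : -(|i1| + |i2|) ≤ σ * (i1 + i2) := by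
          have := neg_abs_le (σ * (i1 + i2))
          rw [abs_mul, hσ, one_mul] at this
          linarith [abs_add_le i1 i2]
        have e6 : ‖μ‖ * (1 + n₂ ^ 2) * (2 * (‖y x‖ * ‖w x‖)) ≤
            ‖μ‖ * (1 + n₂ ^ 2) * (‖y x‖ ^ 2 + ‖w x‖ ^ 2) := by
          gcongr
          nlinarith [sq_nonneg (‖y x‖ - ‖w x‖)]
        have : 0 ≤ (2 * (σ * (i1 + i2)) + (σ * c) * (‖y x‖ ^ 2 + ‖w x‖ ^ 2)) *
            Real.exp (c * x) := by
          refine mul_nonneg ?_ (Real.exp_pos _).le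
          rw [e4]
          linarith
        linarith)
    simpa only [real_inner_self_eq_norm_sq] using this
  have hK : 0 ≤ ‖μ‖ * (1 + n₂ ^ 2) := by positivity
  set k := ‖μ‖ * (1 + n₂ ^ 2)
  rcases le_total s t with hst | hst
  · have := key (-k) (by rw [abs_neg, abs_of_nonneg hK]) s t hs ht hst (-1) (by simp)
      (by simpa using hK)
    rw [abs_of_nonneg (sub_nonneg.2 hst), mul_sub, sub_eq_add_neg, add_comm (k * t), Real.exp_add,
      ← mul_assoc]
    have h2 : (‖y t‖ ^ 2 + ‖w t‖ ^ 2) * Real.exp (-k * t) ≤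
      (‖y s‖ ^ 2 + ‖w s‖ ^ 2) * Real.exp (-k * s) := by linarith
    calc _ = (‖y t‖ ^ 2 + ‖w t‖ ^ 2) * Real.exp (-k * t) * Real.exp (k * t) := by
          rw [mul_assoc, ← Real.exp_add]; simp
      _ ≤ (‖y s‖ ^ 2 + ‖w s‖ ^ 2) * Real.exp (-k * s) * Real.exp (k * t) := by gcongr
      _ = _ := by rw [neg_mul]
  · have := key k (abs_of_nonneg hK) t s ht hs hst 1 (by simp) (by simpa using hK)
    simp only [one_mul] at this
    rw [abs_of_nonpos (sub_nonpos.2 hst), neg_sub, mul_sub, sub_eq_add_neg, Real.exp_add,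
      ← mul_assoc]
    calc _ = (‖y t‖ ^ 2 + ‖w t‖ ^ 2) * Real.exp (k * t) * Real.exp (-(k * t)) := by
          rw [mul_assoc, ← Real.exp_add]; simp
      _ ≤ _ := by gcongr

/-- For `Re μ ≤ 0` the flux `Re (ȳ w)` does not increase. -/
theorem flux_le (hμ : μ.re ≤ 0) (hε : ∀ s, 0 ≤ ε s) (hab : a ≤ b) (h : IsTrajectory μ ε a b y w) :
    inner ℝ (y b) (w b) ≤ inner ℝ (y a) (w a) := by
  obtain ⟨⟨K, hK⟩, ⟨L, hL⟩, h1, h2⟩ := h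
  have := le_of_ae_hasDerivAt_nonneg hab
    ((absolutelyContinuousOnInterval_inner hab hK hL).const_mul (-1)) (f' := fun x =>
      (-1) * (inner ℝ (y x) (μ * (ε x * y x)) + inner ℝ (μ * w x) (w x))) (by
      filter_upwards [h1, h2] with x hx1 hx2 hx
      refine ⟨((hx1 hx).inner ℝ (hx2 hx)).const_mul (-1), ?_⟩
      -- The factor `-1` turns the decrease of the flux into the nonnegative derivative expected by
      -- `le_of_ae_hasDerivAt_nonneg`.
      have : (-1) * (inner ℝ (y x) (μ * (ε x * y x)) + inner ℝ (μ * w x) (w x)) =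
          (-μ.re) * (ε x * ‖y x‖ ^ 2 + ‖w x‖ ^ 2) := by
        simp only [Complex.inner, Complex.sq_norm, Complex.normSq_apply]
        simp
        ring
      rw [this]
      have := hε x
      exact mul_nonneg (by linarith) (by positivity))
  linarith

end IsTrajectory

/-! ### Concatenation, rescaling, and constant controls. -/

theorem lipschitzOnWith_ite {f g : ℝ → ℂ} {a b c : ℝ} {K L : NNReal} (hab : a ≤ b) (hbc : b ≤ c)
    (hf : LipschitzOnWith K f (Icc a b)) (hg : LipschitzOnWith L g (Icc b c)) (hfg : f b = g b) :
    LipschitzOnWith (max K L) (fun s => if s ≤ b then f s else g s) (Icc a c) := by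
  have key : ∀ s ∈ Icc a c, ∀ t ∈ Icc a c, s ≤ t →
      dist (if s ≤ b then f s else g s) (if t ≤ b then f t else g t) ≤
        (max K L : NNReal) * dist s t := by
    intro s hs t ht hst
    have hK : (K : ℝ) ≤ (max K L : NNReal) := by exact_mod_cast le_max_left K L
    have hL : (L : ℝ) ≤ (max K L : NNReal) := by exact_mod_cast le_max_right K L
    split_ifs with h1 h2 h2
    · exact (hf.dist_le_mul s ⟨hs.1, h1⟩ t ⟨ht.1, h2⟩).trans (by gcongr)
    · push Not at h2
      have e1 := hf.dist_le_mul s ⟨hs.1, h1⟩ b ⟨hab, le_rfl⟩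
      have e2 := hg.dist_le_mul b ⟨le_rfl, hbc⟩ t ⟨h2.le, ht.2⟩
      have e3 : dist s t = dist s b + dist b t := by
        rw [Real.dist_eq, Real.dist_eq, Real.dist_eq, abs_of_nonpos, abs_of_nonpos, abs_of_nonpos]
        <;> linarith
      calc _ ≤ dist (f s) (f b) + dist (g b) (g t) := by rw [← hfg]; exact dist_triangle _ _ _
        _ ≤ K * dist s b + L * dist b t := add_le_add e1 e2
        _ ≤ (max K L : NNReal) * dist s b + (max K L : NNReal) * dist b t := by gcongr
        _ = _ := by rw [e3]; ring
    · exact absurd (hst.trans h2) h1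
    · push Not at h1 h2
      exact (hg.dist_le_mul s ⟨h1.le, hs.2⟩ t ⟨h2.le, ht.2⟩).trans (by gcongr)
  refine LipschitzOnWith.of_dist_le_mul fun s hs t ht => ?_
  rcases le_total s t with h | h
  · exact key s hs t ht h
  · rw [dist_comm, dist_comm s]
    exact key t ht s hs h

namespace IsTrajectory

variable {μ : ℂ} {a b c : ℝ}

/-- The equations are required only almost everywhere, so the junction `b` may be ignored;
continuity there is what keeps the glued functions Lipschitz. -/
theorem concat {ε₁ ε₂ : ℝ → ℝ} {y₁ w₁ y₂ w₂ : ℝ → ℂ} (hab : a ≤ b) (hbc : b ≤ c)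
    (h₁ : IsTrajectory μ ε₁ a b y₁ w₁) (h₂ : IsTrajectory μ ε₂ b c y₂ w₂)
    (hy : y₁ b = y₂ b) (hw : w₁ b = w₂ b) :
    IsTrajectory μ (fun s => if s ≤ b then ε₁ s else ε₂ s) a c
      (fun s => if s ≤ b then y₁ s else y₂ s) (fun s => if s ≤ b then w₁ s else w₂ s) := by
  obtain ⟨⟨K₁, hK₁⟩, ⟨L₁, hL₁⟩, d₁, e₁⟩ := h₁
  obtain ⟨⟨K₂, hK₂⟩, ⟨L₂, hL₂⟩, d₂, e₂⟩ := h₂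
  have hb : ∀ᵐ x : ℝ, x ≠ b := by simp [ae_iff, measure_singleton]
  have hlt : ∀ (f g : ℝ → ℂ) (x : ℝ), x < b → (fun s => if s ≤ b then f s else g s) =ᶠ[𝓝 x] f := by
    intro f g x hx
    filter_upwards [Iio_mem_nhds hx] with s hs
    rw [if_pos (le_of_lt hs)]
  have hgt : ∀ (f g : ℝ → ℂ) (x : ℝ), b < x → (fun s => if s ≤ b then f s else g s) =ᶠ[𝓝 x] g := by
    intro f g x hx
    filter_upwards [Ioi_mem_nhds hx] with s hs
    rw [if_neg (not_le.2 hs)]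
  refine ⟨⟨_, lipschitzOnWith_ite hab hbc hK₁ hK₂ hy⟩, ⟨_, lipschitzOnWith_ite hab hbc hL₁ hL₂ hw⟩,
    ?_, ?_⟩
  · filter_upwards [d₁, d₂, hb] with x h1 h2 h3 hx
    rcases lt_or_gt_of_ne h3 with h | h
    · simp only [if_pos h.le]
      exact (h1 ⟨hx.1, h⟩).congr_of_eventuallyEq (hlt _ _ _ h)
    · simp only [if_neg (not_le.2 h)]
      exact (h2 ⟨h, hx.2⟩).congr_of_eventuallyEq (hgt _ _ _ h)
  · filter_upwards [e₁, e₂, hb] with x h1 h2 h3 hx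
    rcases lt_or_gt_of_ne h3 with h | h
    · simp only [if_pos h.le]
      exact (h1 ⟨hx.1, h⟩).congr_of_eventuallyEq (hlt _ _ _ h)
    · simp only [if_neg (not_le.2 h)]
      exact (h2 ⟨h, hx.2⟩).congr_of_eventuallyEq (hgt _ _ _ h)

/-- The chain rule puts the factor `l` in front of both equations, so a change of time scale is
absorbed by `μ`. -/
theorem comp_affine {ε : ℝ → ℝ} {y w : ℝ → ℂ} {l d : ℝ} (hl : 0 < l)
    (h : IsTrajectory μ ε (l * a + d) (l * b + d) y w) :
    IsTrajectory (l * μ) (fun s => ε (l * s + d)) a b (fun s => y (l * s + d))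
      (fun s => w (l * s + d)) := by
  obtain ⟨⟨K, hK⟩, ⟨L, hL⟩, h1, h2⟩ := h
  have hmaps : MapsTo (fun s : ℝ => l * s + d) (Icc a b) (Icc (l * a + d) (l * b + d)) :=
    fun s hs => ⟨by have := hs.1; simp only; gcongr, by have := hs.2; simp only; gcongr⟩
  have hlip : LipschitzOnWith l.toNNReal (fun s : ℝ => l * s + d) (Icc a b) := by
    refine LipschitzOnWith.of_dist_le_mul fun s _ t _ => ?_
    rw [Real.dist_eq, Real.dist_eq, Real.coe_toNNReal l hl.le, add_sub_add_right_eq_sub, ← mul_sub,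
      abs_mul, abs_of_pos hl]
  -- Exceptional null sets must pull back to null sets under the affine map.
  have hq : Measure.QuasiMeasurePreserving (fun s : ℝ => l * s + d) volume volume := by
    have q1 : Measure.QuasiMeasurePreserving (fun s : ℝ => l * s) volume volume := by
      refine ⟨by fun_prop, ?_⟩
      rw [Real.map_volume_mul_left hl.ne']
      exact Measure.smul_absolutelyContinuous
    exact (measurePreserving_add_right volume d).quasiMeasurePreserving.comp q1
  have hd : ∀ s : ℝ, HasDerivAt (fun s : ℝ => l * s + d) l s := fun s => by
    simpa using ((hasDerivAt_id s).const_mul l).add_const d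
  have hIoo : ∀ s ∈ Ioo a b, l * s + d ∈ Ioo (l * a + d) (l * b + d) := fun s hs =>
    ⟨by have := hs.1; gcongr, by have := hs.2; gcongr⟩
  refine ⟨⟨_, hK.comp hlip hmaps⟩, ⟨_, hL.comp hlip hmaps⟩, ?_, ?_⟩
  · filter_upwards [hq.ae h1] with s hs hx
    exact ((hs (hIoo s hx)).scomp s (hd s)).congr_deriv (by rw [Complex.real_smul, mul_assoc])
  · filter_upwards [hq.ae h2] with s hs hx
    exact ((hs (hIoo s hx)).scomp s (hd s)).congr_deriv (by rw [Complex.real_smul, mul_assoc])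

/-- For the control `m²` the combinations `w ± m y` evolve by the factors `exp (±m μ (s - a))`; the
formulas are these exponentials rewritten. -/
theorem of_const (μ : ℂ) {m : ℝ} (hm : m ≠ 0) (a b : ℝ) (y₀ w₀ : ℂ) :
    IsTrajectory μ (fun _ => m ^ 2) a b
      (fun s => y₀ * Complex.cosh (m * μ * (s - a : ℝ)) + w₀ / m * Complex.sinh (m * μ * (s - a : ℝ)))
      (fun s => w₀ * Complex.cosh (m * μ * (s - a : ℝ)) +
        y₀ * m * Complex.sinh (m * μ * (s - a : ℝ))) := by
  have hm' : (m : ℂ) ≠ 0 := by exact_mod_cast hm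
  have hlin : ∀ s : ℝ, HasDerivAt (fun s : ℝ => (m : ℂ) * μ * (s - a : ℝ)) (m * μ) s := fun s => by
    simpa using (((hasDerivAt_id s).sub_const a).ofReal_comp).const_mul ((m : ℂ) * μ)
  have hcosh : ∀ s : ℝ, HasDerivAt (fun s : ℝ => Complex.cosh (m * μ * (s - a : ℝ)))
      (m * μ * Complex.sinh (m * μ * (s - a : ℝ))) s := fun s =>
    (Complex.hasDerivAt_cosh _).scomp s (hlin s)
  have hsinh : ∀ s : ℝ, HasDerivAt (fun s : ℝ => Complex.sinh (m * μ * (s - a : ℝ)))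
      (m * μ * Complex.cosh (m * μ * (s - a : ℝ))) s := fun s =>
    (Complex.hasDerivAt_sinh _).scomp s (hlin s)
  have hy : ∀ s : ℝ, HasDerivAt (fun s : ℝ => y₀ * Complex.cosh (m * μ * (s - a : ℝ)) +
      w₀ / m * Complex.sinh (m * μ * (s - a : ℝ))) (μ * (w₀ * Complex.cosh (m * μ * (s - a : ℝ)) +
        y₀ * m * Complex.sinh (m * μ * (s - a : ℝ)))) s := fun s => by
    refine (((hcosh s).const_mul y₀).add ((hsinh s).const_mul (w₀ / m))).congr_deriv ?_
    field_simp
    ring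
  have hw : ∀ s : ℝ, HasDerivAt (fun s : ℝ => w₀ * Complex.cosh (m * μ * (s - a : ℝ)) +
        y₀ * m * Complex.sinh (m * μ * (s - a : ℝ))) (μ * ((m ^ 2 : ℝ) *
        (y₀ * Complex.cosh (m * μ * (s - a : ℝ)) +
          w₀ / m * Complex.sinh (m * μ * (s - a : ℝ))))) s := fun s => by
    refine (((hcosh s).const_mul w₀).add ((hsinh s).const_mul (y₀ * m))).congr_deriv ?_
    push_cast
    field_simp
    ring
  have hofReal : ContDiff ℝ 1 fun s : ℝ => (m : ℂ) * μ * (s - a : ℝ) :=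
    contDiff_const.mul (Complex.ofRealCLM.contDiff.comp (contDiff_id.sub contDiff_const))
  have hc : ContDiff ℝ 1 fun s : ℝ => Complex.cosh ((m : ℂ) * μ * (s - a : ℝ)) :=
    (Complex.contDiff_cosh.restrict_scalars ℝ).comp hofReal
  have hs : ContDiff ℝ 1 fun s : ℝ => Complex.sinh ((m : ℂ) * μ * (s - a : ℝ)) :=
    (Complex.contDiff_sinh.restrict_scalars ℝ).comp hofReal
  refine ⟨?_, ?_, Eventually.of_forall fun s _ => hy s, Eventually.of_forall fun s _ => hw s⟩
  · exact ((contDiff_const.mul hc).add (contDiff_const.mul hs)).contDiffOn.exists_lipschitzOnWith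
      (by simp) (convex_Icc a b) isCompact_Icc
  · exact ((contDiff_const.mul hc).add (contDiff_const.mul hs)).contDiffOn.exists_lipschitzOnWith
      (by simp) (convex_Icc a b) isCompact_Icc

end IsTrajectory

theorem IsControl.ite {n₁ n₂ b : ℝ} {ε₁ ε₂ : ℝ → ℝ} (h₁ : IsControl n₁ n₂ ε₁)
    (h₂ : IsControl n₁ n₂ ε₂) : IsControl n₁ n₂ fun s => if s ≤ b then ε₁ s else ε₂ s := by
  refine ⟨h₁.measurable.ite measurableSet_Iic h₂.measurable, fun s => ?_⟩
  split_ifs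
  exacts [h₁.mem s, h₂.mem s]

/-! ### Estimates that survive pointwise limits. -/

theorem lipschitzOnWith_of_norm_sub_le {E : Type*} [NormedAddCommGroup E] {f : ℝ → E} {S : Set ℝ}
    {C : ℝ} (h : ∀ s ∈ S, ∀ t ∈ S, ‖f t - f s‖ ≤ C * |t - s|) :
    LipschitzOnWith C.toNNReal f S := by
  refine LipschitzOnWith.of_dist_le_mul fun s hs t ht => ?_
  rw [dist_eq_norm, Real.dist_eq]
  exact (h t ht s hs).trans (by gcongr; exact Real.le_coe_toNNReal C)

/-- A remainder of second order lets `f` inherit differentiability from `e`. It serves with `e` the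
identity for `y`, and with `e` a primitive of the control for `w`. -/
theorem hasDerivAt_of_quadratic_bound {f : ℝ → ℂ} {e : ℝ → ℝ} {A : ℂ} {a b s C e' : ℝ}
    (hs : s ∈ Ioo a b) (he : HasDerivAt e e' s)
    (h : ∀ t ∈ Icc a b, ‖f t - f s - A * (e t - e s)‖ ≤ C * |t - s| * |t - s|) :
    HasDerivAt f (A * e') s := by
  have h0 : HasDerivAt (fun t => f t - A * e t) 0 s := by
    rw [hasDerivAt_iff_isLittleO]
    have hO : (fun t => f t - A * e t - (f s - A * e s) - (t - s) • (0 : ℂ)) =O[𝓝 s]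
        fun t => |t - s| * |t - s| := by
      refine Asymptotics.IsBigO.of_bound C ?_
      filter_upwards [Icc_mem_nhds hs.1 hs.2] with t ht
      rw [Real.norm_of_nonneg (by positivity), ← mul_assoc]
      convert h t ht using 2
      rw [smul_zero]; ring
    refine hO.trans_isLittleO ?_
    have h1 : (fun t : ℝ => |t - s|) =o[𝓝 s] fun _ => (1 : ℝ) := by
      rw [Asymptotics.isLittleO_one_iff]
      have : Tendsto (fun t : ℝ => |t - s|) (𝓝 s) (𝓝 |s - s|) :=
        (continuous_id.sub continuous_const).abs.tendsto s
      simpa using this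
    have h2 : (fun t : ℝ => |t - s|) =O[𝓝 s] fun t => t - s :=
      (Asymptotics.isBigO_refl _ _).norm_left
    simpa using h1.mul_isBigO h2
  have := h0.add (he.ofReal_comp.const_mul A)
  rw [zero_add] at this
  exact this.congr_of_eventuallyEq (Eventually.of_forall fun t => by simp)

namespace IsControl

variable {n₁ n₂ : ℝ} {ε : ℝ → ℝ}

theorem intervalIntegrable (h : IsControl n₁ n₂ ε) (a b : ℝ) : IntervalIntegrable ε volume a b :=
  intervalIntegrable_of_norm_le h.measurable.aestronglyMeasurable
    (fun s => by rw [Real.norm_of_nonneg (h.nonneg s)]; exact (h.mem s).2) a b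

theorem integral_mem (h : IsControl n₁ n₂ ε) {a s t : ℝ} (hst : s ≤ t) :
    (∫ x in a..t, ε x) - ∫ x in a..s, ε x ∈ Icc (n₁ ^ 2 * (t - s)) (n₂ ^ 2 * (t - s)) := by
  rw [intervalIntegral.integral_interval_sub_left (h.intervalIntegrable _ _)
    (h.intervalIntegrable _ _)]
  constructor
  · have := intervalIntegral.integral_mono_on hst (_root_.intervalIntegrable_const (c := n₁ ^ 2))
      (h.intervalIntegrable s t) fun x _ => (h.mem x).1
    simpa [mul_comm] using this
  · have := intervalIntegral.integral_mono_on hst (h.intervalIntegrable s t)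
      (_root_.intervalIntegrable_const (c := n₂ ^ 2)) fun x _ => (h.mem x).2
    simpa [mul_comm] using this

theorem ae_hasDerivAt_integral (h : IsControl n₁ n₂ ε) (a : ℝ) :
    ∀ᵐ s, HasDerivAt (fun s => ∫ x in a..s, ε x) (ε s) s := by
  have hl := locallyIntegrable_of_norm_le h.measurable.aestronglyMeasurable
    fun s => (Real.norm_of_nonneg (h.nonneg s)).trans_le (h.mem s).2
  filter_upwards [LocallyIntegrable.ae_hasDerivAt_integral hl] with s hs using hs a

end IsControl

theorem abs_sub_le_of_slope_mem {E : ℝ → ℝ} {a b l u : ℝ} (hl : 0 ≤ l)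
    (hE : ∀ s ∈ Icc a b, ∀ t ∈ Icc a b, s ≤ t → E t - E s ∈ Icc (l * (t - s)) (u * (t - s)))
    {s t : ℝ} (hs : s ∈ Icc a b) (ht : t ∈ Icc a b) : ‖E t - E s‖ ≤ u * |t - s| := by
  rcases le_total s t with h | h
  · have := hE s hs t ht h
    have h0 : 0 ≤ l * (t - s) := mul_nonneg hl (sub_nonneg.2 h)
    rw [abs_of_nonneg (sub_nonneg.2 h), Real.norm_of_nonneg (h0.trans this.1)]
    exact this.2
  · have := hE t ht s hs h
    have h0 : 0 ≤ l * (s - t) := mul_nonneg hl (sub_nonneg.2 h)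
    rw [abs_sub_comm, abs_of_nonneg (sub_nonneg.2 h), norm_sub_rev,
      Real.norm_of_nonneg (h0.trans this.1)]
    exact this.2

theorem deriv_mem_of_slope_mem {E : ℝ → ℝ} {a b l u : ℝ}
    (hE : ∀ s ∈ Icc a b, ∀ t ∈ Icc a b, s ≤ t → E t - E s ∈ Icc (l * (t - s)) (u * (t - s)))
    {s e' : ℝ} (hs : s ∈ Ioo a b) (hd : HasDerivAt E e' s) : e' ∈ Icc l u := by
  have ht := (hasDerivAt_iff_tendsto_slope.1 hd).mono_left
    (nhdsWithin_mono s (fun x (hx : s < x) => hx.ne') : 𝓝[>] s ≤ 𝓝[≠] s)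
  refine isClosed_Icc.mem_of_tendsto ht ?_
  filter_upwards [Ioo_mem_nhdsGT hs.2] with t ht
  have := hE s (Ioo_subset_Icc_self hs) t ⟨hs.1.le.trans ht.1.le, ht.2.le⟩ ht.1.le
  have h0 : 0 < t - s := sub_pos.2 ht.1
  rw [slope_def_field]
  exact ⟨(le_div_iff₀ h0).2 this.1, (div_le_iff₀ h0).2 this.2⟩

namespace IsTrajectory

variable {n₁ n₂ : ℝ} {μ : ℂ} {ε : ℝ → ℝ} {a b M : ℝ} {y w : ℝ → ℂ}

theorem norm_fst_sub_le (h : IsTrajectory μ ε a b y w) (hM : ∀ s ∈ Icc a b, ‖w s‖ ≤ M)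
    {s t : ℝ} (hs : s ∈ Icc a b) (ht : t ∈ Icc a b) : ‖y t - y s‖ ≤ ‖μ‖ * M * |t - s| := by
  obtain ⟨K, hK⟩ := h.lipschitz_fst
  refine norm_sub_le_of_ae_hasDerivAt hK h.ae_hasDerivAt_fst hs ht fun x hx => ?_
  rw [norm_mul]
  gcongr
  exact hM x (uIcc_subset_Icc hs ht hx)

theorem norm_snd_sub_le (hε : IsControl n₁ n₂ ε) (h : IsTrajectory μ ε a b y w)
    (hM : ∀ s ∈ Icc a b, ‖y s‖ ≤ M)
    {s t : ℝ} (hs : s ∈ Icc a b) (ht : t ∈ Icc a b) :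
    ‖w t - w s‖ ≤ ‖μ‖ * (n₂ ^ 2 * M) * |t - s| := by
  obtain ⟨K, hK⟩ := h.lipschitz_snd
  refine norm_sub_le_of_ae_hasDerivAt hK h.ae_hasDerivAt_snd hs ht fun x hx => ?_
  rw [norm_mul, norm_mul]
  gcongr
  · exact hε.norm_le x
  · exact hM x (uIcc_subset_Icc hs ht hx)

theorem norm_fst_sub_sub_le (hε : IsControl n₁ n₂ ε) (h : IsTrajectory μ ε a b y w)
    (hM : ∀ s ∈ Icc a b, ‖y s‖ ≤ M) {s t : ℝ} (hs : s ∈ Icc a b) (ht : t ∈ Icc a b) :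
    ‖y t - y s - μ * w s * (t - s)‖ ≤ ‖μ‖ * (‖μ‖ * (n₂ ^ 2 * M)) * |t - s| * |t - s| := by
  obtain ⟨K, hK⟩ := h.lipschitz_fst
  have hM0 : 0 ≤ M := (norm_nonneg _).trans (hM s hs)
  have hlin : ∀ x : ℝ, HasDerivAt (fun x : ℝ => μ * w s * (x : ℂ)) (μ * w s) x := fun x => by
    simpa using ((hasDerivAt_id x).ofReal_comp).const_mul (μ * w s)
  have hLip : LipschitzOnWith (‖μ * w s‖).toNNReal (fun x : ℝ => μ * w s * (x : ℂ)) (Icc a b) := by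
    refine lipschitzOnWith_of_norm_sub_le fun x _ z _ => ?_
    rw [← mul_sub, norm_mul, ← Complex.ofReal_sub, Complex.norm_real, Real.norm_eq_abs]
  have := norm_sub_le_of_ae_hasDerivAt (hK.sub hLip) (f' := fun x => μ * w x - μ * w s)
    (C := ‖μ‖ * (‖μ‖ * (n₂ ^ 2 * M)) * |t - s|)
    (h.ae_hasDerivAt_fst.mono fun x hx h => (hx h).sub (hlin x)) hs ht fun x hx => by
      rw [← mul_sub, norm_mul, mul_assoc]
      gcongr
      refine (h.norm_snd_sub_le hε hM hs (uIcc_subset_Icc hs ht hx)).trans ?_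
      gcongr 1
      exact abs_sub_left_of_mem_uIcc hx
  refine (le_of_eq ?_).trans this
  congr 1
  ring

/-- Only `y` is frozen at `s`; the control stays inside its primitive. Controls converge only
weakly, whereas their primitives converge pointwise, so this form passes to the limit. -/
theorem norm_snd_sub_sub_le (hε : IsControl n₁ n₂ ε) (h : IsTrajectory μ ε a b y w)
    (hM : ∀ s ∈ Icc a b, ‖w s‖ ≤ M) {s t : ℝ} (hs : s ∈ Icc a b) (ht : t ∈ Icc a b) :
    ‖w t - w s - μ * y s * ((∫ x in a..t, ε x : ℝ) - (∫ x in a..s, ε x : ℝ))‖ ≤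
      ‖μ‖ * (n₂ ^ 2 * (‖μ‖ * M)) * |t - s| * |t - s| := by
  obtain ⟨K, hK⟩ := h.lipschitz_snd
  have hM0 : 0 ≤ M := (norm_nonneg _).trans (hM s hs)
  have hLip : LipschitzOnWith (‖μ * y s‖ * n₂ ^ 2).toNNReal
      (fun x : ℝ => μ * y s * ((∫ x in a..x, ε x : ℝ) : ℂ)) (Icc a b) := by
    refine lipschitzOnWith_of_norm_sub_le fun x hx z hz => ?_
    rw [← mul_sub, norm_mul, ← Complex.ofReal_sub, Complex.norm_real, mul_assoc]
    gcongr
    exact abs_sub_le_of_slope_mem (sq_nonneg n₁) (fun s _ t _ hst => hε.integral_mem hst) hx hz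
  have := norm_sub_le_of_ae_hasDerivAt (hK.sub hLip)
    (f' := fun x => μ * (ε x * y x) - μ * y s * (ε x : ℂ))
    (C := ‖μ‖ * (n₂ ^ 2 * (‖μ‖ * M)) * |t - s|) (by
      filter_upwards [h.ae_hasDerivAt_snd, hε.ae_hasDerivAt_integral a] with x hx h2 h
      exact (hx h).sub (h2.ofReal_comp.const_mul _)) hs ht fun x hx => by
      have e : μ * (ε x * y x) - μ * y s * (ε x : ℂ) = μ * (ε x * (y x - y s)) := by ring
      rw [e, norm_mul, norm_mul, mul_assoc, mul_assoc (n₂ ^ 2)]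
      gcongr
      · exact hε.norm_le x
      refine (h.norm_fst_sub_le hM hs (uIcc_subset_Icc hs ht hx)).trans ?_
      gcongr 1
      exact abs_sub_left_of_mem_uIcc hx
  refine (le_of_eq ?_).trans this
  congr 1
  ring

end IsTrajectory

/-- A system of quadratic estimates characterizing trajectories; it is stable under pointwise
limits. -/
theorem exists_control_of_quadratic_bounds {n₁ n₂ : ℝ} (hn : n₁ ^ 2 ≤ n₂ ^ 2) {μ : ℂ} {a b C D : ℝ}
    (hab : a ≤ b) {E : ℝ → ℝ} {y w : ℝ → ℂ}
    (hE : ∀ s ∈ Icc a b, ∀ t ∈ Icc a b, s ≤ t →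
      E t - E s ∈ Icc (n₁ ^ 2 * (t - s)) (n₂ ^ 2 * (t - s)))
    (hy : ∀ s ∈ Icc a b, ∀ t ∈ Icc a b, ‖y t - y s‖ ≤ D * |t - s|)
    (hw : ∀ s ∈ Icc a b, ∀ t ∈ Icc a b, ‖w t - w s‖ ≤ D * |t - s|)
    (hyw : ∀ s ∈ Icc a b, ∀ t ∈ Icc a b,
      ‖y t - y s - μ * w s * (t - s)‖ ≤ C * |t - s| * |t - s|)
    (hwy : ∀ s ∈ Icc a b, ∀ t ∈ Icc a b,
      ‖w t - w s - μ * y s * (E t - E s)‖ ≤ C * |t - s| * |t - s|) :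
    ∃ ε, IsControl n₁ n₂ ε ∧ IsTrajectory μ ε a b y w := by
  have hEL : LipschitzOnWith (n₂ ^ 2).toNNReal E (Icc a b) :=
    lipschitzOnWith_of_norm_sub_le fun s hs t ht =>
      abs_sub_le_of_slope_mem (sq_nonneg n₁) hE hs ht
  have hEd := (LipschitzOnWith.absolutelyContinuousOnInterval
    (by rwa [uIcc_of_le hab] : LipschitzOnWith _ E (uIcc a b))).ae_differentiableAt
  -- The limit control is `E'`. Clamping only matters on the null set of `[a, b]` where `E` is not
  -- differentiable, at the endpoints, and outside the interval; elsewhere the slope bounds already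
  -- put `E'` in the range.
  refine ⟨fun s => max (n₁ ^ 2) (min (n₂ ^ 2) (deriv E s)), ⟨?_, fun s => ?_⟩,
    ⟨_, lipschitzOnWith_of_norm_sub_le hy⟩, ⟨_, lipschitzOnWith_of_norm_sub_le hw⟩, ?_, ?_⟩
  · exact measurable_const.max (measurable_const.min (measurable_deriv E))
  · exact ⟨le_max_left _ _, max_le hn (min_le_left _ _)⟩
  · refine Eventually.of_forall fun s hs => ?_
    simpa using hasDerivAt_of_quadratic_bound hs (hasDerivAt_id s)
      (by simpa using hyw s (Ioo_subset_Icc_self hs))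
  · filter_upwards [hEd] with s hd hs
    have hs' := Ioo_subset_Icc_self hs
    have hd' := (hd (by rwa [uIcc_of_le hab])).hasDerivAt
    have hmem := deriv_mem_of_slope_mem hE hs hd'
    rw [min_eq_right hmem.2, max_eq_right hmem.1]
    exact (hasDerivAt_of_quadratic_bound hs hd' (hwy s hs')).congr_deriv (by ring)

/-! ### The steering set: half-plane, dilations, closedness. -/

/-- The set of `μ` for which some control steers the system from the line `α w = β y` at `a` to
the line `w = p y` at `b` along a nontrivial trajectory. -/
def steeringSet (n₁ n₂ α β p a b : ℝ) : Set ℂ :=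
  {μ | ∃ ε y w, IsControl n₁ n₂ ε ∧ IsTrajectory μ ε a b y w ∧
    (α : ℂ) * w a = β * y a ∧ y b ≠ 0 ∧ w b = p * y b}

/-- If `Re μ ≤ 0` the flux could not increase from its nonpositive value at `a` to the positive
value `p ‖y b‖²` at `b`. -/
theorem re_pos_of_mem_steeringSet {n₁ n₂ α β p a b : ℝ} {μ : ℂ} (hab : a ≤ b) (hp : 0 < p)
    (hαβ : (α = 0 ∧ β = 1) ∨ (α = 1 ∧ β ≤ 0)) (h : μ ∈ steeringSet n₁ n₂ α β p a b) :
    0 < μ.re := by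
  obtain ⟨ε, y, w, hε, ht, h1, h2, h3⟩ := h
  by_contra! hμ
  have := ht.flux_le hμ hε.nonneg hab
  have hb : 0 < inner ℝ (y b) (w b) := by
    rw [h3, ← Complex.real_smul, inner_smul_right, real_inner_self_eq_norm_sq]
    have := norm_pos_iff.2 h2
    positivity
  have ha : inner ℝ (y a) (w a) ≤ 0 := by
    rcases hαβ with ⟨rfl, rfl⟩ | ⟨rfl, hβ⟩
    · have : y a = 0 := by simpa using h1.symm
      simp [this]
    · have : w a = β * y a := by simpa using h1
      rw [this, ← Complex.real_smul, inner_smul_right, real_inner_self_eq_norm_sq]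
      exact mul_nonpos_of_nonpos_of_nonneg hβ (sq_nonneg _)
  linarith

theorem smul_mem_steeringSet_of_mem {n₁ n₂ α β p a b a' b' : ℝ} {μ : ℂ} (hab : a < b)
    (hab' : a' < b') (h : μ ∈ steeringSet n₁ n₂ α β p a' b') :
    (((b' - a') / (b - a) : ℝ) : ℂ) * μ ∈ steeringSet n₁ n₂ α β p a b := by
  obtain ⟨ε, y, w, hε, ht, h1, h2, h3⟩ := h
  have hba : 0 < b - a := sub_pos.2 hab
  set l := (b' - a') / (b - a) with hl
  have hl0 : 0 < l := div_pos (sub_pos.2 hab') hba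
  have ea : l * a + (a' - l * a) = a' := by ring
  have eb : l * b + (a' - l * a) = b' := by
    have : l * (b - a) = b' - a' := by rw [hl]; field_simp
    linarith
  refine ⟨fun s => ε (l * s + (a' - l * a)), _, _,
    ⟨hε.measurable.comp (by fun_prop), fun s => hε.mem _⟩,
    IsTrajectory.comp_affine hl0 (d := a' - l * a) (by rwa [ea, eb]), ?_, ?_, ?_⟩
  · simpa only [ea] using h1
  · simpa only [eb] using h2
  · simpa only [eb] using h3

/-- Waiting on the target line under the control `p²` prolongs the steering to an interval `c` times
as long; rescaling to `[a, b]` then multiplies `μ` by `c`. -/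
theorem dilation_mem_steeringSet {n₁ n₂ α β p a b c : ℝ} {μ : ℂ} (hn₁ : 0 < n₁)
    (hp : p ∈ Icc n₁ n₂) (hab : a < b) (hc : 1 ≤ c) (h : μ ∈ steeringSet n₁ n₂ α β p a b) :
    (c : ℂ) * μ ∈ steeringSet n₁ n₂ α β p a b := by
  have hba : 0 < b - a := sub_pos.2 hab
  have hp0 : p ≠ 0 := (hn₁.trans_le hp.1).ne'
  have hpc : (p : ℂ) ≠ 0 := by exact_mod_cast hp0
  have hb' : b ≤ a + c * (b - a) := by nlinarith
  have key : μ ∈ steeringSet n₁ n₂ α β p a (a + c * (b - a)) := by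
    obtain ⟨ε, y, w, hε, ht, h1, h2, h3⟩ := h
    have hcat := ht.concat hab.le hb'
      (IsTrajectory.of_const μ hp0 b (a + c * (b - a)) (y b) (w b)) (by simp) (by simp)
    rcases hb'.eq_or_lt with he | hlt
    · rw [← he]
      exact ⟨ε, y, w, hε, ht, h1, h2, h3⟩
    -- On the line `w = p y` the motion is a pure exponential, so the line is invariant and `y`
    -- stays nonzero.
    have hy : ∀ z : ℂ, y b * Complex.cosh z + w b / p * Complex.sinh z = y b * Complex.exp z := by
      intro z
      rw [h3, ← Complex.cosh_add_sinh]
      field_simp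
    refine ⟨_, _, _, hε.ite (isControl_const hn₁ hp), hcat, ?_, ?_, ?_⟩
    · simpa only [if_pos hab.le] using h1
    · simp only [if_neg (not_le.2 hlt), hy]
      exact mul_ne_zero h2 (Complex.exp_ne_zero _)
    · simp only [if_neg (not_le.2 hlt), hy]
      rw [h3, ← Complex.cosh_add_sinh]
      ring
  have := smul_mem_steeringSet_of_mem hab (hab.trans_le hb') key
  convert this using 2
  rw [add_sub_cancel_left, mul_div_cancel_right₀ _ hba.ne']

theorem isClosed_steeringSet {n₁ n₂ α β p a b : ℝ} (hn : n₁ ^ 2 ≤ n₂ ^ 2) (hab : a ≤ b) :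
    IsClosed (steeringSet n₁ n₂ α β p a b) := by
  refine IsSeqClosed.isClosed fun μ ν hμ hν => ?_
  -- Normalizing `y b = 1` prevents the limit trajectory from degenerating; energy estimates run
  -- backwards from `b` then bound all states uniformly by `M`.
  have hnorm : ∀ n, ∃ ε y w, IsControl n₁ n₂ ε ∧ IsTrajectory (μ n) ε a b y w ∧
      (α : ℂ) * w a = β * y a ∧ y b = 1 ∧ w b = p := by
    intro n
    obtain ⟨ε, y, w, hε, ht, h1, h2, h3⟩ := hμ n
    refine ⟨ε, _, _, hε, ht.const_mul (y b)⁻¹, ?_, inv_mul_cancel₀ h2, ?_⟩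
    · linear_combination (y b)⁻¹ * h1
    · rw [h3]; field_simp
  choose ε y w hε ht h1 h2 h3 using hnorm
  obtain ⟨R, hR⟩ := hν.norm.bddAbove_range
  replace hR : ∀ n, ‖μ n‖ ≤ R := fun n => hR ⟨n, rfl⟩
  have hR0 : 0 ≤ R := (norm_nonneg _).trans (hR 0)
  set M := √((1 + p ^ 2) * Real.exp (R * (1 + n₂ ^ 2) * (b - a))) with hMdef
  have hM0 : 0 ≤ M := Real.sqrt_nonneg _
  have hMb : ∀ n, ∀ s ∈ Icc a b, ‖y n s‖ ^ 2 + ‖w n s‖ ^ 2 ≤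
      (1 + p ^ 2) * Real.exp (R * (1 + n₂ ^ 2) * (b - a)) := by
    intro n s hs
    refine ((ht n).energy_le (hε n) (right_mem_Icc.2 hab) hs).trans ?_
    rw [h2, h3, Complex.norm_real, norm_one, one_pow, Real.norm_eq_abs, sq_abs]
    gcongr
    · exact hR n
    · rw [abs_sub_comm, abs_of_nonneg (sub_nonneg.2 hs.2)]
      linarith [hs.1]
  have hyM : ∀ n, ∀ s ∈ Icc a b, ‖y n s‖ ≤ M := fun n s hs =>
    Real.le_sqrt_of_sq_le (by linarith [hMb n s hs, sq_nonneg ‖w n s‖])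
  have hwM : ∀ n, ∀ s ∈ Icc a b, ‖w n s‖ ≤ M := fun n s hs =>
    Real.le_sqrt_of_sq_le (by linarith [hMb n s hs, sq_nonneg ‖y n s‖])
  -- An ultrafilter gives limits at all points of `[a, b]` simultaneously, without extracting
  -- subsequences.
  set U : Ultrafilter ℕ := hyperfilter ℕ
  have hU : (U : Filter ℕ) ≤ atTop := Nat.hyperfilter_le_atTop
  have hνU : Tendsto μ U (𝓝 ν) := hν.mono_left hU
  have hlimC : ∀ f : ℕ → ℂ, (∀ n, ‖f n‖ ≤ M) → ∃ l, Tendsto f U (𝓝 l) := by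
    intro f hf
    obtain ⟨l, -, hl⟩ := (isCompact_closedBall (0 : ℂ) M).ultrafilter_le_nhds (U.map f)
      (by
        rw [Ultrafilter.coe_map, le_principal_iff, mem_map]
        exact Eventually.of_forall fun n => by simpa using hf n)
    exact ⟨l, hl⟩
  have hlimE : ∀ s ∈ Icc a b, ∃ l, Tendsto (fun n => ∫ x in a..s, ε n x) U (𝓝 l) := by
    intro s hs
    obtain ⟨l, -, hl⟩ := (isCompact_Icc (a := n₁ ^ 2 * (s - a)) (b := n₂ ^ 2 * (s - a))
      ).ultrafilter_le_nhds (U.map fun n => ∫ x in a..s, ε n x) (by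
        rw [Ultrafilter.coe_map, le_principal_iff, mem_map]
        exact Eventually.of_forall fun n => by simpa using (hε n).integral_mem (a := a) hs.1)
    exact ⟨l, hl⟩
  have hlimy : ∀ s ∈ Icc a b, ∃ l, Tendsto (fun n => y n s) U (𝓝 l) := fun s hs =>
    hlimC _ fun n => hyM n s hs
  have hlimw : ∀ s ∈ Icc a b, ∃ l, Tendsto (fun n => w n s) U (𝓝 l) := fun s hs =>
    hlimC _ fun n => hwM n s hs
  choose! E hE using hlimE
  choose! Y hY using hlimy
  choose! W hW using hlimw
  have hba := right_mem_Icc.2 hab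
  have haa := left_mem_Icc.2 hab
  obtain ⟨e, he, htr⟩ := exists_control_of_quadratic_bounds hn hab (μ := ν) (E := E) (y := Y)
    (w := W) (C := R * (R * (n₂ ^ 2 * M))) (D := R * ((1 + n₂ ^ 2) * M))
    (fun s hs t ht hst => isClosed_Icc.mem_of_tendsto ((hE t ht).sub (hE s hs))
      (Eventually.of_forall fun n => (hε n).integral_mem hst))
    (fun s hs t ht' => le_of_tendsto ((hY t ht').sub (hY s hs)).norm
      (Eventually.of_forall fun n => ((ht n).norm_fst_sub_le (hwM n) hs ht').trans (by
        gcongr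
        · exact hR n
        · nlinarith [sq_nonneg n₂])))
    (fun s hs t ht' => le_of_tendsto ((hW t ht').sub (hW s hs)).norm
      (Eventually.of_forall fun n => ((ht n).norm_snd_sub_le (hε n) (hyM n) hs ht').trans (by
        gcongr
        · exact hR n
        · nlinarith [sq_nonneg n₂])))
    (fun s hs t ht' => le_of_tendsto
      (((hY t ht').sub (hY s hs)).sub ((hνU.mul (hW s hs)).mul tendsto_const_nhds)).norm
      (Eventually.of_forall fun n => ((ht n).norm_fst_sub_sub_le (hε n) (hyM n) hs ht').trans (by
        have := hR n
        gcongr)))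
    (fun s hs t ht' => le_of_tendsto
      (((hW t ht').sub (hW s hs)).sub ((hνU.mul (hY s hs)).mul
        (((Complex.continuous_ofReal.tendsto _).comp (hE t ht')).sub
          ((Complex.continuous_ofReal.tendsto _).comp (hE s hs))))).norm
      (Eventually.of_forall fun n => ((ht n).norm_snd_sub_sub_le (hε n) (hwM n) hs ht').trans (by
        have := hR n
        calc ‖μ n‖ * (n₂ ^ 2 * (‖μ n‖ * M)) * |t - s| * |t - s|
            = ‖μ n‖ * (‖μ n‖ * (n₂ ^ 2 * M)) * |t - s| * |t - s| := by ring
          _ ≤ _ := by gcongr)))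
  have hYb : Y b = 1 := tendsto_nhds_unique (hY b hba) (by simp only [h2]; exact tendsto_const_nhds)
  have hWb : W b = p := tendsto_nhds_unique (hW b hba) (by simp only [h3]; exact tendsto_const_nhds)
  refine ⟨e, Y, W, he, htr, ?_, by simp [hYb], by simp [hYb, hWb]⟩
  refine tendsto_nhds_unique ((hW a haa).const_mul (α : ℂ)) ?_
  simp only [h1]
  exact (hY a haa).const_mul (β : ℂ)

/-! ### Spirals and reachability of the target line. -/

/-- A curve leaving the origin with nonzero velocity meets every logarithmic spiral
`t ↦ exp (-λ t)` winding around the origin, arbitrarily close to its starting point. -/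
theorem exists_eq_exp_neg_mul {H : ℝ → ℂ} {h₀ l : ℂ} {P : ℝ → Prop} (hH : HasDerivAt H h₀ 0)
    (hH0 : H 0 = 0) (hh₀ : h₀ ≠ 0) (hc : ∀ᶠ τ in 𝓝[>] 0, ContinuousAt H τ)
    (hP : ∀ᶠ τ in 𝓝[>] 0, P τ) (hre : 0 < l.re) (him : l.im ≠ 0) :
    ∃ τ > 0, ∃ t ≥ 0, P τ ∧ H τ = Complex.exp (-l * (t : ℝ)) := by
  have hq : Tendsto (fun τ : ℝ => H τ / (τ * h₀)) (𝓝[>] 0) (𝓝 1) := by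
    have h1 := ((hasDerivAt_iff_tendsto_slope.1 hH).mono_left
      (nhdsWithin_mono 0 (fun x (hx : 0 < x) => hx.ne') : 𝓝[>] (0 : ℝ) ≤ 𝓝[≠] 0)).div_const h₀
    rw [div_self hh₀] at h1
    refine h1.congr fun τ => ?_
    rw [slope_def_module, hH0, sub_zero, sub_zero, Complex.real_smul, Complex.ofReal_inv]
    rw [← div_eq_inv_mul, div_div]
  have hslit : ∀ᶠ τ : ℝ in 𝓝[>] 0, H τ / (τ * h₀) ∈ Complex.slitPlane :=
    hq.eventually (Complex.isOpen_slitPlane.mem_nhds Complex.one_mem_slitPlane)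
  have hlog : ∀ᶠ τ : ℝ in 𝓝[>] 0, ‖Complex.log (H τ / (τ * h₀))‖ < 1 := by
    have := (hq.clog Complex.one_mem_slitPlane).norm
    rw [Complex.log_one, norm_zero] at this
    exact this.eventually (gt_mem_nhds one_pos)
  -- This makes `Re (F τ) ≤ 0` below, which yields `t ≥ 0`.
  have hneg : ∀ᶠ τ : ℝ in 𝓝[>] 0, Real.log τ ≤ -(1 + ‖Complex.log h₀‖) :=
    Real.tendsto_log_nhdsGT_zero.eventually (eventually_le_atBot _)
  obtain ⟨δ, hδ, hall⟩ := mem_nhdsGT_iff_exists_Ioo_subset.1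
    (hP.and (hc.and (hslit.and (hlog.and hneg))))
  replace hδ : 0 < δ := hδ
  -- `F` is a continuous logarithm of `H`. It remains to find `τ` and an integer `k` such that `F τ
  -- + 2πik` lies on the ray `-l t`, `t ≥ 0`.
  set F : ℝ → ℂ := fun τ => (Real.log τ : ℂ) + (Complex.log (H τ / (τ * h₀)) + Complex.log h₀)
    with hF
  have hFexp : ∀ τ ∈ Ioo 0 δ, Complex.exp (F τ) = H τ := by
    intro τ hτ
    have hne : H τ / (τ * h₀) ≠ 0 := Complex.slitPlane_ne_zero (hall hτ).2.2.1
    have hτ0 : (τ : ℂ) ≠ 0 := by exact_mod_cast hτ.1.ne'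
    rw [hF]
    simp only [Complex.exp_add]
    rw [Complex.exp_log hne, Complex.exp_log hh₀, ← Complex.ofReal_exp, Real.exp_log hτ.1]
    field_simp
  have hG : ∀ τ ∈ Ioo 0 δ, ‖Complex.log (H τ / (τ * h₀)) + Complex.log h₀‖ ≤
      1 + ‖Complex.log h₀‖ := fun τ hτ =>
    (norm_add_le _ _).trans (by have := (hall hτ).2.2.2.1.le; gcongr)
  -- Being on the real line through `l` means that `Im (Z * conj l) = 0`. The extra factor `l.im`
  -- makes `ψ` tend to `+∞` at `0` whatever the sign of `l.im`, so the intermediate value theorem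
  -- reaches the level `V` belonging to `k`.
  set ψ : ℝ → ℝ := fun τ => (F τ * (starRingEnd ℂ) l).im * l.im with hψ
  have hFc : ContinuousOn F (Ioo 0 δ) := by
    intro τ hτ
    have hτ0 : (τ : ℂ) ≠ 0 := by exact_mod_cast hτ.1.ne'
    refine ContinuousAt.continuousWithinAt ?_
    refine (Complex.continuous_ofReal.continuousAt.comp
      (Real.continuousAt_log hτ.1.ne')).add (ContinuousAt.add ?_ continuousAt_const)
    refine ContinuousAt.clog ?_ (hall hτ).2.2.1
    exact (hall hτ).2.1.div (Complex.continuous_ofReal.continuousAt.mul continuousAt_const)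
      (mul_ne_zero hτ0 hh₀)
  have hψc : ContinuousOn ψ (Ioo 0 δ) :=
    (Complex.continuous_im.comp_continuousOn (hFc.mul continuousOn_const)).mul continuousOn_const
  have hψlb : ∀ τ ∈ Ioo 0 δ,
      -Real.log τ * l.im ^ 2 - (1 + ‖Complex.log h₀‖) * ‖l‖ * |l.im| ≤ ψ τ := by
    intro τ hτ
    have e1 : ψ τ = -Real.log τ * l.im ^ 2 +
        ((Complex.log (H τ / (τ * h₀)) + Complex.log h₀) * (starRingEnd ℂ) l).im * l.im := by
      simp only [hψ, hF]
      rw [add_mul, Complex.add_im, Complex.im_ofReal_mul, Complex.conj_im]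
      ring
    have e2 : |((Complex.log (H τ / (τ * h₀)) + Complex.log h₀) * (starRingEnd ℂ) l).im * l.im| ≤
        (1 + ‖Complex.log h₀‖) * ‖l‖ * |l.im| := by
      rw [abs_mul]
      gcongr
      refine (Complex.abs_im_le_norm _).trans ?_
      rw [norm_mul, Complex.norm_conj]
      gcongr
      exact hG τ hτ
    rw [e1]
    linarith [neg_abs_le
      (((Complex.log (H τ / (τ * h₀)) + Complex.log h₀) * (starRingEnd ℂ) l).im * l.im)]
  have hhalf : δ / 2 ∈ Ioo 0 δ := ⟨by linarith, by linarith⟩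
  have hπ : 2 * Real.pi * l.re * l.im ≠ 0 := by
    have := Real.pi_pos
    positivity
  obtain ⟨k, hk⟩ : ∃ k : ℤ, ψ (δ / 2) ≤ -(k * (2 * Real.pi * l.re * l.im)) := by
    obtain ⟨n, hn⟩ := exists_nat_ge (ψ (δ / 2) / |2 * Real.pi * l.re * l.im|)
    rw [div_le_iff₀ (abs_pos.2 hπ)] at hn
    rcases abs_cases (2 * Real.pi * l.re * l.im) with ⟨h, -⟩ | ⟨h, -⟩
    · refine ⟨-n, hn.trans_eq ?_⟩
      rw [h]; push_cast; ring
    · refine ⟨n, hn.trans_eq ?_⟩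
      rw [h]; push_cast; ring
  set V := -(k * (2 * Real.pi * l.re * l.im)) with hV
  obtain ⟨τ₀, hτ₀, hτ₀V⟩ : ∃ τ₀ ∈ Ioo 0 (δ / 2), V ≤ ψ τ₀ := by
    have h1 : ∀ᶠ τ : ℝ in 𝓝[>] 0, Real.log τ ≤
        -((V + (1 + ‖Complex.log h₀‖) * ‖l‖ * |l.im|) / l.im ^ 2) :=
      Real.tendsto_log_nhdsGT_zero.eventually (eventually_le_atBot _)
    obtain ⟨τ, h, hτ⟩ := (h1.and (Ioo_mem_nhdsGT hhalf.1)).exists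
    refine ⟨τ, hτ, le_trans ?_ (hψlb τ ⟨hτ.1, hτ.2.trans hhalf.2⟩)⟩
    rw [le_neg, div_le_iff₀ (by positivity)] at h
    linarith
  obtain ⟨τ, hτ, hτV⟩ : ∃ τ ∈ Icc τ₀ (δ / 2), ψ τ = V :=
    intermediate_value_Icc' hτ₀.2.le
      (hψc.mono fun x hx => ⟨hτ₀.1.trans_le hx.1, hx.2.trans_lt hhalf.2⟩) ⟨hk, hτ₀V⟩
  have hτδ : τ ∈ Ioo 0 δ := ⟨hτ₀.1.trans_le hτ.1, hτ.2.trans_lt hhalf.2⟩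
  set Z : ℂ := F τ + k * (2 * Real.pi * Complex.I) with hZ
  have hZim : (Z * (starRingEnd ℂ) l).im = 0 := by
    have : (F τ * (starRingEnd ℂ) l).im = -(k * (2 * Real.pi * l.re)) := by
      have h2 : (F τ * (starRingEnd ℂ) l).im * l.im = -(k * (2 * Real.pi * l.re)) * l.im := by
        rw [hV] at hτV
        linear_combination hτV
      exact mul_right_cancel₀ him h2
    rw [hZ, add_mul, Complex.add_im, this]
    simp [Complex.mul_im]
    ring
  have hl0 : l ≠ 0 := fun h => hre.ne' (by simp [h])
  have hns : (Complex.normSq l : ℂ) ≠ 0 := by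
    exact_mod_cast (Complex.normSq_pos.2 hl0).ne'
  set t : ℝ := -((Z * (starRingEnd ℂ) l).re / Complex.normSq l) with ht
  have hZt : Z = -l * t := by
    have h1 : Z * (starRingEnd ℂ) l = ((Z * (starRingEnd ℂ) l).re : ℂ) :=
      Complex.ext (by simp) (by rw [hZim]; simp)
    rw [ht]
    push_cast
    rw [← h1]
    field_simp
    rw [← Complex.mul_conj]
    ring
  have hZre : Z.re ≤ 0 := by
    have h1 : Z.re = Real.log τ +
        (Complex.log (H τ / (τ * h₀)) + Complex.log h₀).re := by
      simp [hZ, hF]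
    have h2 := (Complex.re_le_norm _).trans (hG τ hτδ)
    have h3 := (hall hτδ).2.2.2.2
    linarith
  refine ⟨τ, hτδ.1, t, ?_, (hall hτδ).1, ?_⟩
  · have : Z.re = -(l.re * t) := by rw [hZt]; simp
    have h2 : 0 ≤ l.re * t := by linarith
    exact nonneg_of_mul_nonneg_right h2 hre
  · rw [← hZt, hZ, Complex.exp_add, Complex.exp_int_mul_two_pi_mul_I, mul_one, hFexp τ hτδ]

/-- The system can be steered from the state `P` to the state `Q` in time `T`. -/
def Reachable (n₁ n₂ : ℝ) (μ : ℂ) (P Q : ℂ × ℂ) (T : ℝ) : Prop :=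
  0 ≤ T ∧ ∃ ε y w, IsControl n₁ n₂ ε ∧ IsTrajectory μ ε 0 T y w ∧
    (y 0, w 0) = P ∧ (y T, w T) = Q

theorem Reachable.append_const {n₁ n₂ m T t : ℝ} {μ : ℂ} {P Q : ℂ × ℂ} (hn₁ : 0 < n₁)
    (hm : m ∈ Icc n₁ n₂) (ht : 0 ≤ t) (h : Reachable n₁ n₂ μ P Q T) :
    Reachable n₁ n₂ μ P (Q.1 * Complex.cosh (m * μ * t) + Q.2 / m * Complex.sinh (m * μ * t),
      Q.2 * Complex.cosh (m * μ * t) + Q.1 * m * Complex.sinh (m * μ * t)) (T + t) := by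
  rcases ht.eq_or_lt with rfl | ht
  · simpa using h
  obtain ⟨hT, ε, y, w, hε, htr, rfl, rfl⟩ := h
  have hm0 : m ≠ 0 := (hn₁.trans_le hm.1).ne'
  refine ⟨by linarith, _, _, _, hε.ite (isControl_const hn₁ hm), htr.concat hT
    (by linarith) (IsTrajectory.of_const μ hm0 T (T + t) (y T) (w T)) (by simp) (by simp), ?_, ?_⟩
  · simp [hT]
  · simp [ht]

theorem reachable_refl {n₁ n₂ : ℝ} (hn₁ : 0 < n₁) (hn : n₁ ≤ n₂) (μ : ℂ) (P : ℂ × ℂ) :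
    Reachable n₁ n₂ μ P P 0 := by
  refine ⟨le_rfl, _, _, _, isControl_const hn₁ ⟨le_rfl, hn⟩,
    IsTrajectory.of_const μ hn₁.ne' 0 0 P.1 P.2, ?_, ?_⟩ <;> simp

/-- The final state satisfies `y ≠ 0`: otherwise it would vanish entirely, and the backward energy
estimate would force `P = 0`. -/
theorem Reachable.mem_steeringSet {n₁ n₂ α β p T : ℝ} {μ : ℂ} {P Q : ℂ × ℂ} (hP : P ≠ 0)
    (hP' : (α : ℂ) * P.2 = β * P.1) (hQ : Q.2 = p * Q.1) (h : Reachable n₁ n₂ μ P Q T) :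
    μ ∈ steeringSet n₁ n₂ α β p 0 T := by
  obtain ⟨hT, ε, y, w, hε, htr, rfl, rfl⟩ := h
  refine ⟨ε, y, w, hε, htr, hP', fun h0 => hP ?_, hQ⟩
  have hw : w T = 0 := by simpa [h0] using hQ
  have := htr.energy_le hε (right_mem_Icc.2 hT) (left_mem_Icc.2 hT)
  rw [h0, hw] at this
  simp only [norm_zero, ne_eq, OfNat.ofNat_ne_zero, not_false_eq_true, zero_pow, add_zero,
    zero_mul] at this
  have h1 : ‖y 0‖ ^ 2 = 0 := by nlinarith [sq_nonneg ‖y 0‖, sq_nonneg ‖w 0‖]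
  have h2 : ‖w 0‖ ^ 2 = 0 := by nlinarith [sq_nonneg ‖y 0‖, sq_nonneg ‖w 0‖]
  simpa using And.intro h1 h2

theorem sinh_ne_zero_of_re_pos {z : ℂ} (hz : 0 < z.re) : Complex.sinh z ≠ 0 := by
  intro h
  rw [Complex.sinh, div_eq_zero_iff, or_iff_left (two_ne_zero), sub_eq_zero] at h
  have := congrArg norm h
  rw [Complex.norm_exp, Complex.norm_exp, Real.exp_eq_exp, Complex.neg_re] at this
  linarith

/-- The lines `w = p y` and `w = -p y` are invariant under the control `p²`, so the spiral argument
must start off both. The initial state is already off both unless `β = -p`; then a short use of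
another control `m²` leaves `w = -p y`. -/
theorem exists_reachable_ne {n₁ n₂ α β p m : ℝ} {μ : ℂ} (hn₁ : 0 < n₁)
    (hp : p ∈ Icc n₁ n₂) (hm : m ∈ Icc n₁ n₂) (hmp : m ≠ p) (hre : 0 < μ.re)
    (hαβ : (α = 0 ∧ β = 1) ∨ (α = 1 ∧ β ≤ 0)) :
    ∃ T Q, Reachable n₁ n₂ μ (α, β) Q T ∧ Q.2 - p * Q.1 ≠ 0 ∧ Q.2 + p * Q.1 ≠ 0 := by
  have hn : n₁ ≤ n₂ := hp.1.trans hp.2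
  have hp0 : 0 < p := hn₁.trans_le hp.1
  have hm0 : 0 < m := hn₁.trans_le hm.1
  rcases hαβ with ⟨rfl, rfl⟩ | ⟨rfl, hβ⟩
  · exact ⟨0, _, reachable_refl hn₁ hn μ _, by simp, by simp⟩
  by_cases hβp : β = -p
  · have hcont : Tendsto (fun t : ℝ => (-p * Complex.cosh (m * μ * t) + m * Complex.sinh (m * μ * t))
        - p * (Complex.cosh (m * μ * t) + -p / m * Complex.sinh (m * μ * t))) (𝓝[>] 0)
        (𝓝 (-2 * p)) := by
      refine tendsto_nhdsWithin_of_tendsto_nhds ?_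
      have : Continuous (fun t : ℝ =>
        (-p * Complex.cosh (m * μ * t) + m * Complex.sinh (m * μ * t))
        - p * (Complex.cosh (m * μ * t) + -p / m * Complex.sinh (m * μ * t)) : ℝ → ℂ) := by
        have hz : Continuous fun t : ℝ => (m : ℂ) * μ * t :=
          continuous_const.mul Complex.continuous_ofReal
        have hC := Complex.continuous_cosh.comp hz
        have hS := Complex.continuous_sinh.comp hz
        exact ((continuous_const.mul hC).add (continuous_const.mul hS)).sub
          (continuous_const.mul (hC.add (continuous_const.mul hS)))
      convert this.tendsto 0 using 2
      simp
      ring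
    have hne : (-2 * p : ℂ) ≠ 0 := by
      have : (p : ℂ) ≠ 0 := by exact_mod_cast hp0.ne'
      simpa using this
    obtain ⟨t, h1, ht⟩ := ((hcont.eventually_ne hne).and self_mem_nhdsWithin).exists
    have ht : 0 < t := ht
    refine ⟨_, _, (reachable_refl hn₁ hn μ _).append_const hn₁ hm ht.le, ?_, ?_⟩
    · simpa [hβp] using h1
    · have hmc : (m : ℂ) ≠ 0 := by exact_mod_cast hm0.ne'
      have hS : Complex.sinh (m * μ * t) ≠ 0 := by
        refine sinh_ne_zero_of_re_pos ?_
        rw [mul_assoc, Complex.re_ofReal_mul, Complex.re_mul_ofReal]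
        positivity
      have e : (m : ℂ) - p ^ 2 / m ≠ 0 := by
        have h2 : m ^ 2 - p ^ 2 ≠ 0 := by
          rw [sq_sub_sq]
          exact mul_ne_zero (by positivity) (sub_ne_zero.2 hmp)
        have h3 : (m : ℂ) ^ 2 - p ^ 2 ≠ 0 := by exact_mod_cast h2
        intro h
        apply h3
        field_simp at h
        simpa using h
      convert mul_ne_zero e hS using 1
      simp only [hβp]
      push_cast
      field_simp
      ring
  · refine ⟨0, _, reachable_refl hn₁ hn μ _, ?_, ?_⟩
    · have : β - p ≠ 0 := by linarith
      simp only [Complex.ofReal_one, mul_one]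
      exact_mod_cast this
    · have : β + p ≠ 0 := fun h => hβp (by linarith)
      simp only [Complex.ofReal_one, mul_one]
      exact_mod_cast this

theorem exists_smul_mem_steeringSet {n₁ n₂ α β p a b : ℝ} {μ : ℂ} (hn₁ : 0 < n₁) (hn : n₁ < n₂)
    (hp : p ∈ Icc n₁ n₂) (hab : a < b) (hαβ : (α = 0 ∧ β = 1) ∨ (α = 1 ∧ β ≤ 0))
    (hre : 0 < μ.re) (him : μ.im ≠ 0) :
    ∃ c > 0, ((c : ℝ) : ℂ) * μ ∈ steeringSet n₁ n₂ α β p a b := by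
  obtain ⟨m, hm, hmp⟩ : ∃ m ∈ Icc n₁ n₂, m ≠ p := by
    by_cases h : p = n₁
    · exact ⟨n₂, right_mem_Icc.2 hn.le, by rw [h]; exact hn.ne'⟩
    · exact ⟨n₁, left_mem_Icc.2 hn.le, fun h' => h h'.symm⟩
  have hp0 : 0 < p := hn₁.trans_le hp.1
  have hm0 : 0 < m := hn₁.trans_le hm.1
  have hpc : (p : ℂ) ≠ 0 := by exact_mod_cast hp0.ne'
  have hmc : (m : ℂ) ≠ 0 := by exact_mod_cast hm0.ne'
  have hμ0 : μ ≠ 0 := fun h => hre.ne' (by simp [h])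
  obtain ⟨T, Q, hQ, hu, hs⟩ := exists_reachable_ne hn₁ hp hm hmp hre hαβ
  set u := Q.2 - p * Q.1 with hu_def
  set s := Q.2 + p * Q.1 with hs_def
  have hmp2 : (m : ℂ) / p - p / m ≠ 0 := by
    have h2 : m ^ 2 - p ^ 2 ≠ 0 := by
      rw [sq_sub_sq]
      exact mul_ne_zero (by positivity) (sub_ne_zero.2 hmp)
    have h3 : (m : ℂ) ^ 2 - p ^ 2 ≠ 0 := by exact_mod_cast h2
    intro h
    apply h3
    field_simp at h
    simpa using h
  -- After time `t` with control `p²`, `u` and `s` are multiplied by `exp (-p μ t)` and `exp (p μ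
  -- t)`. A further time `τ` with control `m²` reaches `w = p y` exactly when `N τ = D τ * exp (-2 p
  -- μ t)`, so `N / D` is the curve to be met by the spiral.
  set D : ℝ → ℂ := fun τ => 2 * Complex.cosh (m * μ * τ) - (p / m + m / p) * Complex.sinh (m * μ * τ)
    with hD
  set N : ℝ → ℂ := fun τ => -(s / u) * (m / p - p / m) * Complex.sinh (m * μ * τ) with hN
  have hlin : ∀ τ : ℝ, HasDerivAt (fun τ : ℝ => (m : ℂ) * μ * τ) (m * μ) τ := fun τ => by
    simpa using ((hasDerivAt_id τ).ofReal_comp).const_mul ((m : ℂ) * μ)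
  have hcosh : ∀ τ : ℝ, HasDerivAt (fun τ : ℝ => Complex.cosh (m * μ * τ))
      (m * μ * Complex.sinh (m * μ * τ)) τ := fun τ =>
    (Complex.hasDerivAt_cosh _).scomp τ (hlin τ)
  have hsinh : ∀ τ : ℝ, HasDerivAt (fun τ : ℝ => Complex.sinh (m * μ * τ))
      (m * μ * Complex.cosh (m * μ * τ)) τ := fun τ =>
    (Complex.hasDerivAt_sinh _).scomp τ (hlin τ)
  have hDd : ∀ τ : ℝ, HasDerivAt D _ τ := fun τ =>
    ((hcosh τ).const_mul 2).sub ((hsinh τ).const_mul ((p : ℂ) / m + m / p))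
  have hNd : ∀ τ : ℝ, HasDerivAt N _ τ := fun τ =>
    (hsinh τ).const_mul (-(s / u) * (m / p - p / m))
  have hD0 : D 0 = 2 := by simp [hD]
  have hN0 : N 0 = 0 := by simp [hN]
  have hDne : ∀ᶠ τ in 𝓝[>] 0, D τ ≠ 0 :=
    nhdsWithin_le_nhds ((hDd 0).continuousAt.eventually_ne (by rw [hD0]; exact two_ne_zero))
  have hHd := (hNd 0).div (hDd 0) (by rw [hD0]; exact two_ne_zero)
  obtain ⟨τ, hτ, t, ht, hDτ, hHτ⟩ := exists_eq_exp_neg_mul (l := 2 * p * μ) hHd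
    (by simp [hN0]) (by
      rw [hN0, hD0]
      simp only [Complex.ofReal_zero, mul_zero, Complex.cosh_zero, mul_one, zero_mul, sub_zero]
      have : -(s / u) ≠ 0 := neg_ne_zero.2 (div_ne_zero hs hu)
      exact div_ne_zero (mul_ne_zero (mul_ne_zero (mul_ne_zero this hmp2) (mul_ne_zero hmc hμ0))
        two_ne_zero) (pow_ne_zero 2 two_ne_zero))
    (hDne.mono fun τ hτ => (hNd τ).continuousAt.div (hDd τ).continuousAt hτ) hDne
    (by
      rw [mul_assoc, Complex.mul_re, Complex.re_ofReal_mul]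
      simp
      positivity)
    (by
      rw [mul_assoc, Complex.mul_im, Complex.im_ofReal_mul]
      simp
      exact ⟨hp0.ne', him⟩)
  have hreach := (hQ.append_const hn₁ hp ht).append_const hn₁ hm hτ.le
  have hmem := hreach.mem_steeringSet (α := α) (β := β) (p := p)
    (by rcases hαβ with ⟨rfl, rfl⟩ | ⟨rfl, -⟩ <;> simp) (by ring) (by
      have hH : N τ = D τ * Complex.exp (-(2 * p * μ) * t) := by
        rw [← hHτ, Pi.div_apply]; field_simp
      have e2 : Complex.exp (-(2 * p * μ) * t) =
          (Complex.cosh (p * μ * t) - Complex.sinh (p * μ * t)) *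
          (Complex.cosh (p * μ * t) - Complex.sinh (p * μ * t)) := by
        rw [Complex.cosh_sub_sinh, ← Complex.exp_add]; ring_nf
      have e3 := Complex.cosh_sq_sub_sinh_sq (p * μ * t)
      rw [e2] at hH
      simp only [hN, hD] at hH
      set C := Complex.cosh (p * μ * t)
      set S := Complex.sinh (p * μ * t)
      set C' := Complex.cosh (m * μ * τ)
      set S' := Complex.sinh (m * μ * τ)
      -- The left side is twice the value of `w - p y` at the final time.
      have e4 : s * (C + S) * ((m / p - p / m) * S') +
          u * (C - S) * (2 * C' - (p / m + m / p) * S') = 0 := by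
        have h1 : s * ((m / p - p / m) * S') + u * ((2 * C' - (p / m + m / p) * S') *
            ((C - S) * (C - S))) = 0 := by
          rw [← hH]; field_simp; ring
        linear_combination (C + S) * h1 - (u * (C - S) * (2 * C' - (p / m + m / p) * S')) * e3
      rw [hu_def, hs_def] at e4
      field_simp at e4 ⊢
      linear_combination (1 / 2 : ℂ) * e4)
  have := smul_mem_steeringSet_of_mem hab (by
    have := hQ.1
    linarith : (0 : ℝ) < T + t + τ) hmem
  refine ⟨_, ?_, this⟩
  have := hQ.1
  have := sub_pos.2 hab
  have : 0 < T + t + τ - 0 := by linarith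
  positivity

/-! ### Eigenvalues as steering parameters. -/

theorem Feasible.exists_isControl {n₁ n₂ a b : ℝ} {ε : ℝ → ℝ} (hn : n₁ ^ 2 ≤ n₂ ^ 2)
    (h : Feasible n₁ n₂ a b ε) :
    ∃ e, IsControl n₁ n₂ e ∧ ∀ᵐ s, s ∈ Ioo a b → ε s = e s := by
  refine ⟨fun s => max (n₁ ^ 2) (min (n₂ ^ 2) (h.aemeasurable.mk ε s)), ⟨?_, fun s => ?_⟩, ?_⟩
  · exact measurable_const.max (measurable_const.min h.aemeasurable.measurable_mk)
  · exact ⟨le_max_left _ _, max_le hn (min_le_left _ _)⟩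
  · have h1 := (ae_restrict_iff' measurableSet_Ioo).1 h.aemeasurable.ae_eq_mk
    have h2 := (ae_restrict_iff' measurableSet_Ioo).1 h.bounds
    filter_upwards [h1, h2] with s h1 h2 hs
    rw [← h1 hs, min_eq_right (h2 hs).2, max_eq_right (h2 hs).1]

theorem IsControl.feasible {n₁ n₂ : ℝ} {ε : ℝ → ℝ} (h : IsControl n₁ n₂ ε) (a b : ℝ) :
    Feasible n₁ n₂ a b ε :=
  ⟨h.measurable.aemeasurable, Eventually.of_forall h.mem⟩

theorem IsSolution.isTrajectory {n₁ n₂ a b : ℝ} {ε e : ℝ → ℝ} {κ : ℂ} {y v : ℝ → ℂ} (hab : a ≤ b)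
    (hκ : κ ≠ 0) (he : IsControl n₁ n₂ e) (hεe : ∀ᵐ s, s ∈ Ioo a b → ε s = e s)
    (h : IsSolution a b ε κ y v) :
    IsTrajectory (Complex.I * κ) e a b y (fun s => v s / (Complex.I * κ)) := by
  have hIκ : Complex.I * κ ≠ 0 := mul_ne_zero Complex.I_ne_zero hκ
  have hb : ∀ᵐ x : ℝ, x ≠ b := by simp [ae_iff, measure_singleton]
  have hyc : ContinuousOn y (Icc a b) := fun s hs => (h.deriv_eq s hs).continuousWithinAt
  obtain ⟨M, hM⟩ := isCompact_Icc.exists_bound_of_continuousOn hyc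
  -- Extending `y` by constants makes the integrand bounded on the whole line, so Lebesgue
  -- differentiation applies to its primitive.
  set Y : ℝ → ℂ := IccExtend hab ((Icc a b).domRestrict y) with hY
  have hYc : Continuous Y := (continuousOn_iff_continuous_domRestrict.1 hyc).Icc_extend'
  have hYe : ∀ s ∈ Icc a b, Y s = y s := fun s hs => by
    rw [hY, IccExtend_of_mem _ _ hs]; rfl
  have hYM : ∀ s, ‖Y s‖ ≤ M := fun s => hM _ (projIcc a b hab s).2
  set f : ℝ → ℂ := fun t => -κ ^ 2 * (e t : ℂ) * Y t with hf
  have hfm : AEStronglyMeasurable f := by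
    have h1 : Measurable fun t => (e t : ℂ) := Complex.measurable_ofReal.comp he.measurable
    exact ((measurable_const.mul h1).mul hYc.measurable).aestronglyMeasurable
  have hfC : ∀ s, ‖f s‖ ≤ ‖κ‖ ^ 2 * n₂ ^ 2 * M := by
    intro s
    rw [hf, norm_mul, norm_mul, norm_neg, norm_pow]
    gcongr
    · exact he.norm_le s
    · exact hYM s
  have hfi := intervalIntegrable_of_norm_le hfm hfC
  have hveq : ∀ s ∈ Icc a b, v s = v a + ∫ t in a..s, f t := by
    intro s hs
    rw [h.eqn s hs]
    congr 1
    refine intervalIntegral.integral_congr_ae ?_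
    filter_upwards [hεe, hb] with t ht htb hts
    rw [uIoc_of_le hs.1] at hts
    have htI : t ∈ Ioo a b := ⟨hts.1, lt_of_le_of_ne (hts.2.trans hs.2) htb⟩
    rw [hf]
    simp only
    rw [ht htI, hYe t (Ioo_subset_Icc_self htI)]
  have hvL : LipschitzOnWith (‖κ‖ ^ 2 * n₂ ^ 2 * M).toNNReal v (Icc a b) := by
    refine lipschitzOnWith_of_norm_sub_le fun s hs t ht => ?_
    rw [hveq s hs, hveq t ht, add_sub_add_left_eq_sub,
      intervalIntegral.integral_interval_sub_left (hfi _ _) (hfi _ _)]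
    exact intervalIntegral.norm_integral_le_of_norm_le_const fun x _ => hfC x
  obtain ⟨V, hV⟩ := isCompact_Icc.exists_bound_of_continuousOn hvL.continuousOn
  have hloc := locallyIntegrable_of_norm_le hfm hfC
  have hwL := (ContinuousLinearMap.mul ℝ ℂ (Complex.I * κ)⁻¹).lipschitz.comp_lipschitzOnWith hvL
  have hwe : (ContinuousLinearMap.mul ℝ ℂ (Complex.I * κ)⁻¹) ∘ v =
      fun s => v s / (Complex.I * κ) := by
    ext s
    simp [div_eq_inv_mul]
  rw [hwe] at hwL
  refine ⟨⟨V.toNNReal, ?_⟩, ⟨_, hwL⟩, ?_, ?_⟩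
  · refine (convex_Icc a b).lipschitzOnWith_of_nnnorm_hasDerivWithin_le h.deriv_eq fun s hs => ?_
    rw [← NNReal.coe_le_coe, coe_nnnorm]
    exact (hV s hs).trans (Real.le_coe_toNNReal V)
  · refine Eventually.of_forall fun s hs => ?_
    rw [mul_div_cancel₀ _ hIκ]
    exact (h.deriv_eq s (Ioo_subset_Icc_self hs)).hasDerivAt (Icc_mem_nhds hs.1 hs.2)
  · filter_upwards [LocallyIntegrable.ae_hasDerivAt_integral hloc] with s hs hsI
    have hd : HasDerivAt v (f s) s := by
      refine ((hs a).const_add (v a)).congr_of_eventuallyEq ?_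
      filter_upwards [Icc_mem_nhds hsI.1 hsI.2] with t ht using hveq t ht
    refine (hd.div_const (Complex.I * κ)).congr_deriv ?_
    rw [hf]
    simp only
    rw [hYe s (Ioo_subset_Icc_self hsI), div_eq_iff hIκ]
    linear_combination (-κ ^ 2 * e s * y s) * Complex.I_sq

theorem IsTrajectory.isSolution {a b : ℝ} {ε : ℝ → ℝ} {κ : ℂ} {y w : ℝ → ℂ} (hab : a ≤ b)
    (h : IsTrajectory (Complex.I * κ) ε a b y w) :
    IsSolution a b ε κ y (fun s => Complex.I * κ * w s) := by
  obtain ⟨K, hK⟩ := h.lipschitz_fst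
  obtain ⟨L, hL⟩ := h.lipschitz_snd
  set W : ℝ → ℂ := IccExtend hab ((Icc a b).domRestrict w) with hW
  have hWc : Continuous W :=
    (continuousOn_iff_continuous_domRestrict.1 h.continuousOn_snd).Icc_extend'
  have hWe : ∀ s ∈ Icc a b, W s = w s := fun s hs => by
    rw [hW, IccExtend_of_mem _ _ hs]; rfl
  have haa := left_mem_Icc.2 hab
  constructor
  · intro s hs
    have hc : Continuous fun t => Complex.I * κ * W t := continuous_const.mul hWc
    have hd := (hc.integral_hasStrictDerivAt a s).hasDerivAt.const_add (y a)
    rw [hWe s hs] at hd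
    refine hd.hasDerivWithinAt.congr_of_mem (fun t ht => ?_) hs
    have := integral_eq_sub_of_ae_hasDerivAt ht.1 (hK.mono (Icc_subset_Icc_right ht.2))
      (h.mono haa ht).ae_hasDerivAt_fst
    have h2 : ∫ x in a..t, Complex.I * κ * W x = ∫ x in a..t, Complex.I * κ * w x := by
      refine intervalIntegral.integral_congr fun x hx => ?_
      rw [uIcc_of_le ht.1] at hx
      simp only [hWe x ⟨hx.1, hx.2.trans ht.2⟩]
    rw [h2, this]
    ring
  · intro s hs
    have := integral_eq_sub_of_ae_hasDerivAt hs.1 (hL.mono (Icc_subset_Icc_right hs.2))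
      (h.mono haa hs).ae_hasDerivAt_snd
    have h2 : ∫ t in a..s, -κ ^ 2 * (ε t : ℂ) * y t =
        ∫ t in a..s, Complex.I * κ * (Complex.I * κ * (ε t * y t)) := by
      refine intervalIntegral.integral_congr fun x _ => ?_
      linear_combination (-κ ^ 2 * ε x * y x) * Complex.I_sq
    rw [h2, intervalIntegral.integral_const_mul, this]
    ring

theorem boundaryCondition_coe_iff {η κ y₀ v₀ : ℂ} :
    BoundaryCondition (η : OnePoint ℂ) κ y₀ v₀ ↔ y₀ ≠ 0 ∧ v₀ / (Complex.I * κ) = η * y₀ := by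
  unfold BoundaryCondition
  constructor
  · rintro (⟨h, -⟩ | ⟨h1, h2⟩)
    · exact absurd h (OnePoint.coe_ne_infty η)
    · refine ⟨h1, ?_⟩
      rw [OnePoint.coe_injective h2]
      field_simp
  · rintro ⟨h1, h2⟩
    refine Or.inr ⟨h1, ?_⟩
    rw [← div_div, h2, mul_div_cancel_right₀ _ h1]

theorem boundaryCondition_infty_iff {κ y₀ v₀ : ℂ} :
    BoundaryCondition ∞ κ y₀ v₀ ↔ y₀ = 0 := by
  unfold BoundaryCondition
  constructor
  · rintro (⟨-, h⟩ | ⟨-, h⟩)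
    · exact h
    · exact absurd h.symm (OnePoint.coe_ne_infty _)
  · exact fun h => Or.inl ⟨rfl, h⟩

theorem mem_achievable_iff {n₁ n₂ α β p a b : ℝ} {ηm : OnePoint ℂ} {κ : ℂ} (hn : n₁ ^ 2 ≤ n₂ ^ 2)
    (hab : a < b) (hp : 0 < p)
    (hη : (ηm = ∞ ∧ α = 0 ∧ β = 1) ∨ (ηm = ((β : ℂ) : OnePoint ℂ) ∧ α = 1 ∧ β ≤ 0)) :
    κ ∈ achievable n₁ n₂ ηm ((p : ℂ) : OnePoint ℂ) a b ↔
      Complex.I * κ ∈ steeringSet n₁ n₂ α β p a b := by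
  constructor
  · rintro ⟨ε, hε, hκ, y, v, hsol, -, hm, hp⟩
    obtain ⟨e, he, hεe⟩ := hε.exists_isControl hn
    rw [boundaryCondition_coe_iff] at hp
    refine ⟨e, y, _, he, hsol.isTrajectory hab.le hκ he hεe, ?_, hp.1, hp.2⟩
    rcases hη with ⟨rfl, rfl, rfl⟩ | ⟨rfl, rfl, -⟩
    · simp [boundaryCondition_infty_iff.1 hm]
    · simp [(boundaryCondition_coe_iff.1 hm).2]
  · intro h
    -- Zero is excluded because steering forces `Re μ > 0`.
    have hκ : κ ≠ 0 := by
      rintro rfl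
      have := re_pos_of_mem_steeringSet hab.le hp (hη.imp And.right And.right) h
      simp at this
    have hIκ : Complex.I * κ ≠ 0 := mul_ne_zero Complex.I_ne_zero hκ
    obtain ⟨ε, y, w, hε, ht, h1, h2, h3⟩ := h
    refine ⟨ε, hε.feasible a b, hκ, y, _, ht.isSolution hab.le,
      ⟨b, right_mem_Icc.2 hab.le, h2⟩, ?_, ?_⟩
    · rcases hη with ⟨rfl, rfl, rfl⟩ | ⟨rfl, rfl, -⟩
      · rw [boundaryCondition_infty_iff]
        simpa using h1.symm
      · have hw : w a = β * y a := by simpa using h1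
        rw [boundaryCondition_coe_iff, mul_div_cancel_left₀ _ hIκ]
        -- If `y a = 0` then `w a = 0` too, and the energy estimate would make the trajectory vanish
        -- at `b`.
        refine ⟨fun h0 => h2 ?_, hw⟩
        have := ht.energy_le hε (left_mem_Icc.2 hab.le) (right_mem_Icc.2 hab.le)
        rw [hw, h0] at this
        simp only [mul_zero, norm_zero, ne_eq, OfNat.ofNat_ne_zero, not_false_eq_true, zero_pow,
          add_zero, zero_mul] at this
        have : ‖y b‖ ^ 2 = 0 := by nlinarith [sq_nonneg ‖y b‖, sq_nonneg ‖w b‖]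
        simpa using this
    · rw [boundaryCondition_coe_iff, mul_div_cancel_left₀ _ hIκ]
      exact ⟨h2, h3⟩

/-! ### From rays to the two Pareto frontiers. -/

theorem norm_mul_exp_arg (κ : ℂ) : (‖κ‖ : ℂ) * Complex.exp (Complex.I * (Complex.arg κ : ℂ)) = κ := by
  rw [mul_comm Complex.I]
  exact Complex.norm_mul_exp_arg_mul_I κ

theorem arg_mul_exp_I_mul {γ : ℝ} (hγ : γ ∈ Ioc (-Real.pi) Real.pi) {r : ℝ} (hr : 0 < r) :
    Complex.arg ((r : ℂ) * Complex.exp (Complex.I * (γ : ℂ))) = γ := by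
  rw [mul_comm Complex.I, Complex.exp_mul_I]
  exact Complex.arg_mul_cos_add_sin_mul_I hr hγ

theorem achievable_arg_mem {n₁ n₂ a b : ℝ} {ηm ηp : OnePoint ℂ}
    (him : ∀ κ ∈ achievable n₁ n₂ ηm ηp a b, κ.im < 0) {γ : ℝ}
    (hγ : γ ∈ achievableArgs n₁ n₂ ηm ηp a b) : γ ∈ Ioo (-Real.pi) 0 := by
  obtain ⟨κ, hκ, rfl⟩ := hγ
  exact ⟨Complex.neg_pi_lt_arg κ, Complex.arg_neg_iff.2 (him κ hκ)⟩

/-- The minimal modulus is attained. -/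
theorem exists_rhoMin_eq {n₁ n₂ a b : ℝ} {ηm ηp : OnePoint ℂ}
    (him : ∀ κ ∈ achievable n₁ n₂ ηm ηp a b, κ.im < 0)
    (hcl : IsClosed (achievable n₁ n₂ ηm ηp a b)) {γ : ℝ}
    (hγ : γ ∈ achievableArgs n₁ n₂ ηm ηp a b) :
    ∃ ρ : ℝ, 0 < ρ ∧ rhoMin n₁ n₂ ηm ηp a b γ = ENNReal.ofReal ρ ∧
      (ρ : ℂ) * Complex.exp (Complex.I * (γ : ℂ)) ∈ achievable n₁ n₂ ηm ηp a b ∧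
      ∀ κ ∈ achievable n₁ n₂ ηm ηp a b, Complex.arg κ = γ → ρ ≤ ‖κ‖ := by
  set S := achievable n₁ n₂ ηm ηp a b with hS
  have hIoo := achievable_arg_mem him hγ
  have hIoc : γ ∈ Ioc (-Real.pi) Real.pi := ⟨hIoo.1, hIoo.2.le.trans Real.pi_pos.le⟩
  set R : Set ℝ := {r | 0 ≤ r ∧ (r : ℂ) * Complex.exp (Complex.I * (γ : ℂ)) ∈ S} with hR
  have hRc : IsClosed R := isClosed_Ici.inter
    (hcl.preimage (Complex.continuous_ofReal.mul continuous_const))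
  have hmemR : ∀ κ ∈ S, Complex.arg κ = γ → ‖κ‖ ∈ R := by
    rintro κ hκ rfl
    exact ⟨norm_nonneg κ, by rwa [norm_mul_exp_arg]⟩
  have hRb : BddBelow R := ⟨0, fun r hr => hr.1⟩
  obtain ⟨κ, hκ, hκγ⟩ := hγ
  have hρ := hRc.csInf_mem ⟨_, hmemR κ hκ hκγ⟩ hRb
  set ρ := sInf R
  have hle : ∀ κ ∈ S, Complex.arg κ = γ → ρ ≤ ‖κ‖ := fun κ hκ h => csInf_le hRb (hmemR κ hκ h)
  -- The infimum belongs to the closed set `R`; it cannot be `0`, as `0` is not in the open lower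
  -- half-plane.
  have hρ0 : 0 < ρ := by
    refine hρ.1.lt_of_ne fun h => ?_
    have := him _ hρ.2
    rw [← h] at this
    simp at this
  refine ⟨ρ, hρ0, le_antisymm (sInf_le ⟨_, hρ.2, arg_mul_exp_I_mul hIoc hρ0, ?_⟩) ?_, hρ.2, hle⟩
  · rw [norm_mul, mul_comm Complex.I, Complex.norm_exp_ofReal_mul_I, mul_one, Complex.norm_real,
      Real.norm_of_nonneg hρ0.le]
  · refine le_sInf ?_
    rintro _ ⟨κ, hκ, h, rfl⟩
    exact ENNReal.ofReal_le_ofReal (hle κ hκ h)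

theorem domRhoMin_eq_achievableArgs (n₁ n₂ a b : ℝ) (ηm ηp : OnePoint ℂ) :
    domRhoMin n₁ n₂ ηm ηp a b = achievableArgs n₁ n₂ ηm ηp a b := by
  ext γ
  constructor
  · intro h
    have h' : rhoMin n₁ n₂ ηm ηp a b γ < ⊤ := h
    obtain ⟨r, ⟨κ, hκ, hγ, -⟩, -⟩ := sInf_lt_iff.1 h'
    exact ⟨κ, hκ, hγ⟩
  · rintro ⟨κ, hκ, hγ⟩
    have h : rhoMin n₁ n₂ ηm ηp a b γ ≤ ENNReal.ofReal ‖κ‖ := sInf_le ⟨κ, hκ, hγ, rfl⟩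
    exact h.trans_lt ENNReal.ofReal_lt_top

/-- A point of `S` is its minimal point on the same ray dilated by `‖κ‖ / ρ ≥ 1`; conversely the
minimal point is attained and its dilations stay in the set. -/
theorem achievable_eq_dilations {n₁ n₂ a b : ℝ} {ηm ηp : OnePoint ℂ}
    (him : ∀ κ ∈ achievable n₁ n₂ ηm ηp a b, κ.im < 0)
    (hcl : IsClosed (achievable n₁ n₂ ηm ηp a b))
    (hdil : ∀ κ ∈ achievable n₁ n₂ ηm ηp a b, ∀ c : ℝ, 1 ≤ c →
      (c : ℂ) * κ ∈ achievable n₁ n₂ ηm ηp a b) :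
    achievable n₁ n₂ ηm ηp a b = {κ | ∃ c : ℝ, 1 ≤ c ∧ ∃ γ ∈ achievableArgs n₁ n₂ ηm ηp a b,
      κ = (c : ℂ) * Complex.exp (Complex.I * (γ : ℂ)) *
        ((rhoMin n₁ n₂ ηm ηp a b γ).toReal : ℂ)} := by
  ext κ
  constructor
  · intro hκ
    have hγ : Complex.arg κ ∈ achievableArgs n₁ n₂ ηm ηp a b := ⟨κ, hκ, rfl⟩
    obtain ⟨ρ, hρ0, hρ, -, hle⟩ := exists_rhoMin_eq him hcl hγ
    have hρc : (ρ : ℂ) ≠ 0 := by exact_mod_cast hρ0.ne'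
    refine ⟨‖κ‖ / ρ, (one_le_div hρ0).2 (hle κ hκ rfl), _, hγ, ?_⟩
    rw [hρ, ENNReal.toReal_ofReal hρ0.le]
    conv_lhs => rw [← norm_mul_exp_arg κ]
    push_cast
    field_simp
  · rintro ⟨c, hc, γ, hγ, rfl⟩
    obtain ⟨ρ, hρ0, hρ, hmem, -⟩ := exists_rhoMin_eq him hcl hγ
    rw [hρ, ENNReal.toReal_ofReal hρ0.le, mul_assoc, mul_comm (Complex.exp _)]
    exact hdil _ hmem c hc

theorem achievable_eq_dilations_modulusFrontier {n₁ n₂ a b : ℝ} {ηm ηp : OnePoint ℂ}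
    (him : ∀ κ ∈ achievable n₁ n₂ ηm ηp a b, κ.im < 0)
    (hcl : IsClosed (achievable n₁ n₂ ηm ηp a b))
    (hdil : ∀ κ ∈ achievable n₁ n₂ ηm ηp a b, ∀ c : ℝ, 1 ≤ c →
      (c : ℂ) * κ ∈ achievable n₁ n₂ ηm ηp a b) :
    achievable n₁ n₂ ηm ηp a b = {κ | ∃ c : ℝ, 1 ≤ c ∧
      ∃ k ∈ modulusFrontier n₁ n₂ ηm ηp a b, κ = (c : ℂ) * k} := by
  rw [achievable_eq_dilations him hcl hdil]
  ext κ
  constructor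
  · rintro ⟨c, hc, γ, hγ, rfl⟩
    exact ⟨c, hc, _, ⟨γ, hγ, rfl⟩, mul_assoc _ _ _⟩
  · rintro ⟨c, hc, _, ⟨γ, hγ, rfl⟩, rfl⟩
    exact ⟨c, hc, γ, hγ, (mul_assoc _ _ _).symm⟩

theorem starConvex_compl_of_dilation {S : Set ℂ} (h0 : (0 : ℂ) ∉ S)
    (hdil : ∀ κ ∈ S, ∀ c : ℝ, 1 ≤ c → (c : ℂ) * κ ∈ S) : StarConvex ℝ (0 : ℂ) Sᶜ := by
  rw [starConvex_zero_iff]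
  intro x hx t ht ht1 hmem
  rcases ht.eq_or_lt with rfl | ht
  · exact h0 (by simpa using hmem)
  · have := hdil _ hmem t⁻¹ ((one_le_inv₀ ht).2 ht1)
    rw [← Complex.real_smul, smul_smul, inv_mul_cancel₀ ht.ne', one_smul] at this
    exact hx this

theorem minDecayRate_dilations (F : Set ℂ) (α : ℝ) :
    minDecayRate {κ | ∃ c : ℝ, 1 ≤ c ∧ ∃ k ∈ F, κ = (c : ℂ) * k} α =
      sInf {r : EReal | ∃ c : ℝ, 1 ≤ c ∧ ∃ k ∈ F,
        c * k.re = α ∧ r = ((-(c * k.im) : ℝ) : EReal)} := by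
  unfold minDecayRate
  congr 1
  ext r
  constructor
  · rintro ⟨β, ⟨c, hc, k, hk, he⟩, rfl⟩
    have hre := congrArg Complex.re he
    have him := congrArg Complex.im he
    simp at hre him
    exact ⟨c, hc, k, hk, hre.symm, by rw [← him, neg_neg]⟩
  · rintro ⟨c, hc, k, hk, hre, rfl⟩
    refine ⟨_, ⟨c, hc, k, hk, ?_⟩, rfl⟩
    apply Complex.ext <;> simp [hre]

end ResonanceOpt

/-! ### The main theorem. -/

theorem theorem7p2 (n₁ n₂ : ℝ) (hn₁ : 0 < n₁) (hn₁₂ : n₁ < n₂)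
    (sm sp : ℝ) (hs : sm < sp)
    (ηm : OnePoint ℂ)
    (hηm : ηm = ∞ ∨ ∃ r : ℝ, r ≤ 0 ∧ ηm = ((r : ℂ) : OnePoint ℂ))
    (ηp : ℝ) (hηp : ηp ∈ Set.Icc n₁ n₂) :
    -- the arguments that are achieved
    (Set.Ioo (-Real.pi) 0 \ {-Real.pi / 2} ⊆
        ResonanceOpt.domRhoMin n₁ n₂ ηm ((ηp : ℂ) : OnePoint ℂ) sm sp ∧
      ResonanceOpt.domRhoMin n₁ n₂ ηm ((ηp : ℂ) : OnePoint ℂ) sm sp =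
        ResonanceOpt.achievableArgs n₁ n₂ ηm ((ηp : ℂ) : OnePoint ℂ) sm sp ∧
      ResonanceOpt.domRhoMin n₁ n₂ ηm ((ηp : ℂ) : OnePoint ℂ) sm sp ⊆ Set.Ioo (-Real.pi) 0) ∧
    -- the achievable set in terms of the minimal modulus
    ResonanceOpt.achievable n₁ n₂ ηm ((ηp : ℂ) : OnePoint ℂ) sm sp =
      {κ | ∃ c : ℝ, 1 ≤ c ∧
        ∃ γ ∈ ResonanceOpt.achievableArgs n₁ n₂ ηm ((ηp : ℂ) : OnePoint ℂ) sm sp,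
          κ = (c : ℂ) * Complex.exp (Complex.I * (γ : ℂ)) *
            ((ResonanceOpt.rhoMin n₁ n₂ ηm ((ηp : ℂ) : OnePoint ℂ) sm sp γ).toReal : ℂ)} ∧
    -- the resonance free region is star-shaped with respect to the origin
    ((0 : ℂ) ∈ (ResonanceOpt.achievable n₁ n₂ ηm ((ηp : ℂ) : OnePoint ℂ) sm sp)ᶜ ∧
      StarConvex ℝ (0 : ℂ) (ResonanceOpt.achievable n₁ n₂ ηm ((ηp : ℂ) : OnePoint ℂ) sm sp)ᶜ) ∧
    -- the minimal decay rate, computed from the frontier of minimal modulus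
    (∀ α : ℝ,
      ResonanceOpt.minDecayRate
          (ResonanceOpt.achievable n₁ n₂ ηm ((ηp : ℂ) : OnePoint ℂ) sm sp) α =
        sInf {r : EReal | ∃ c : ℝ, 1 ≤ c ∧
          ∃ k ∈ ResonanceOpt.modulusFrontier n₁ n₂ ηm ((ηp : ℂ) : OnePoint ℂ) sm sp,
            c * k.re = α ∧ r = ((-(c * k.im) : ℝ) : EReal)}) ∧
    -- the frontier of minimal decay, computed from the frontier of minimal modulus
    ResonanceOpt.decayFrontier
        (ResonanceOpt.achievable n₁ n₂ ηm ((ηp : ℂ) : OnePoint ℂ) sm sp) =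
      ResonanceOpt.decayFrontier
        {κ | ∃ c : ℝ, 1 ≤ c ∧
          ∃ k ∈ ResonanceOpt.modulusFrontier n₁ n₂ ηm ((ηp : ℂ) : OnePoint ℂ) sm sp,
            κ = (c : ℂ) * k} := by
  have hn : n₁ ^ 2 ≤ n₂ ^ 2 := by gcongr
  have hp0 : 0 < ηp := hn₁.trans_le hηp.1
  obtain ⟨α, β, hη⟩ : ∃ α β : ℝ, (ηm = ∞ ∧ α = 0 ∧ β = 1) ∨
      (ηm = ((β : ℂ) : OnePoint ℂ) ∧ α = 1 ∧ β ≤ 0) := by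
    rcases hηm with h | ⟨r, hr, h⟩
    · exact ⟨0, 1, Or.inl ⟨h, rfl, rfl⟩⟩
    · exact ⟨1, r, Or.inr ⟨h, rfl, hr⟩⟩
  have hαβ := hη.imp And.right And.right
  have hmem : ∀ κ, κ ∈ ResonanceOpt.achievable n₁ n₂ ηm ((ηp : ℂ) : OnePoint ℂ) sm sp ↔ _ :=
    fun κ => ResonanceOpt.mem_achievable_iff hn hs hp0 hη
  have him : ∀ κ ∈ ResonanceOpt.achievable n₁ n₂ ηm ((ηp : ℂ) : OnePoint ℂ) sm sp, κ.im < 0 := by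
    intro κ hκ
    have := ResonanceOpt.re_pos_of_mem_steeringSet hs.le hp0 hαβ ((hmem κ).1 hκ)
    simpa using this
  have hcl : IsClosed (ResonanceOpt.achievable n₁ n₂ ηm ((ηp : ℂ) : OnePoint ℂ) sm sp) := by
    have h1 := (ResonanceOpt.isClosed_steeringSet (n₁ := n₁) (n₂ := n₂) (α := α) (β := β)
      (p := ηp) hn hs.le).preimage (continuous_const_mul Complex.I)
    convert h1 using 1
    ext κ
    exact hmem κ
  have hdil : ∀ κ ∈ ResonanceOpt.achievable n₁ n₂ ηm ((ηp : ℂ) : OnePoint ℂ) sm sp,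
      ∀ c : ℝ, 1 ≤ c →
        (c : ℂ) * κ ∈ ResonanceOpt.achievable n₁ n₂ ηm ((ηp : ℂ) : OnePoint ℂ) sm sp := by
    intro κ hκ c hc
    rw [hmem, mul_left_comm]
    exact ResonanceOpt.dilation_mem_steeringSet hn₁ hηp hs hc ((hmem κ).1 hκ)
  have h0 : (0 : ℂ) ∉ ResonanceOpt.achievable n₁ n₂ ηm ((ηp : ℂ) : OnePoint ℂ) sm sp :=
    fun h => by simpa using him 0 h
  have hdom := ResonanceOpt.domRhoMin_eq_achievableArgs n₁ n₂ sm sp ηm ((ηp : ℂ) : OnePoint ℂ)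
  have heq := ResonanceOpt.achievable_eq_dilations_modulusFrontier him hcl hdil
  refine ⟨⟨?_, hdom, ?_⟩, ResonanceOpt.achievable_eq_dilations him hcl hdil,
    ⟨h0, ResonanceOpt.starConvex_compl_of_dilation h0 hdil⟩, fun α => ?_,
    congrArg ResonanceOpt.decayFrontier heq⟩
  · rintro γ ⟨hγ, hγ2⟩
    rw [hdom]
    have hsin : Real.sin γ < 0 := Real.sin_neg_of_neg_of_neg_pi_lt hγ.2 hγ.1
    -- For `μ = I * exp (I γ)` the real and imaginary parts are `-sin γ` and `cos γ`; excluding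
    -- `-π/2` is what makes `μ` nonreal.
    have hcos : Real.cos γ ≠ 0 := by
      intro h
      obtain ⟨k, hk⟩ := Real.cos_eq_zero_iff.1 h
      apply hγ2
      have hπ := Real.pi_pos
      have h1 : (-2 : ℝ) < 2 * k + 1 := by
        by_contra! h
        nlinarith [hγ.1]
      have h2 : (2 * k + 1 : ℝ) < 0 := by
        by_contra! h
        nlinarith [hγ.2]
      have h1' : -2 < 2 * k + 1 := by exact_mod_cast h1
      have h2' : 2 * k + 1 < 0 := by exact_mod_cast h2
      have hk1 : k = -1 := by lia
      rw [hk, hk1, mem_singleton_iff]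
      push_cast
      ring
    obtain ⟨c, hc, hcm⟩ := ResonanceOpt.exists_smul_mem_steeringSet hn₁ hn₁₂ hηp hs hαβ
      (μ := Complex.I * Complex.exp (Complex.I * (γ : ℂ)))
      (by rw [mul_comm _ (γ : ℂ)]; simpa [Complex.exp_ofReal_mul_I_im] using hsin)
      (by rw [mul_comm _ (γ : ℂ)]; simpa [Complex.exp_ofReal_mul_I_re] using hcos)
    refine ⟨(c : ℂ) * Complex.exp (Complex.I * (γ : ℂ)), ?_, ?_⟩
    · rw [hmem, mul_left_comm]
      exact hcm
    · exact ResonanceOpt.arg_mul_exp_I_mul ⟨hγ.1, hγ.2.le.trans Real.pi_pos.le⟩ hc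
  · rw [hdom]
    exact fun γ hγ => ResonanceOpt.achievable_arg_mem him hγ
  · rw [heq, ← ResonanceOpt.minDecayRate_dilations, ← heq]
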